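/- **Setting.** Let $L\ge 1$. A Hermitian Pauli operator is $\pm$ a tensor product of single-qubit matrices $\mathbb 1,X,Y,Z$; it is supported on a set $S$ of qubits if all its tensor factors outside $S$ are $\mathbb 1$. Let $g_2,\dots,g_L$ be commuting, independent Hermitian Pauli operators on $L$ qubits generating a group $\mathcal G\not\ni -\mathbb 1$ (an $[[L,1]]$ stabilizer code), and let $\bar X,\bar Y,\bar Z$ be logical operators of the code: Hermitian Pauli operators commuting with $\mathcal G$ with $\bar X\bar Z=-\bar Z\bar X$ and $\bar Y=i\bar X\bar Z$. A logical operator $\bar\sigma$ is *reducible to* $S$ if $\bar\sigma s$ is supported on $S$ for some $s\in\mathcal G$. A member $g$ of an independent generating family of $\mathcal G$ is *reducible to* $S$ if $gs$ is supported on $S$ for some $s$ in the group generated by the other members. For a density matrix $\rho$ put $$\tilde{\mathcal M}_2(\rho)=-\log_2\frac{\sum_P \mathrm{Tr}[P\rho]^4}{\sum_P \mathrm{Tr}[P\rho]^2},$$ where $P$ runs over all Pauli strings with phase $+1$. **Theorem (bipartite magic gauge).** Let $|\psi\rangle$ be a pure $L$-qubit state with one unit of magic encoding one logical qubit, that is,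 $$\rho=|\psi\rangle\langle\psi|=\frac1{2^L}\Big(\mathbb 1+\frac{\bar Z-\bar Y}{\sqrt2}\Big)\prod_{j=2}^L(\mathbb 1+g_j).$$ Let $A$ be any set of qubits, $B$ its complement and $\rho_A=\mathrm{Tr}_B\,\rho$. 1. There are equivalent logical operators $\bar X'\in\bar X\mathcal G$, $\bar Y'\in\bar Y\mathcal G$, $\bar Z'\in\bar Z\mathcal G$ (again with $\bar X'\bar Z'=-\bar Z'\bar X'$ and $\bar Y'=i\bar X'\bar Z'$) and independent generators $a_1,\dots,a_{n_A},b_1,\dots,b_{n_B},h_1,\dots,h_m$ of $\mathcal G$, with $n_A+n_B+m=L-1$, such that $$\rho=\Big(\frac{\mathbb 1}{2}+\frac{\bar Z'-\bar Y'}{2\sqrt2}\Big)\prod_{i=1}^{n_A}\frac{\mathbb 1+a_i}{2}\prod_{j=1}^{n_B}\frac{\mathbb 1+b_j}{2}\prod_{k=1}^{m}\frac{\mathbb 1+h_k}{2}.$$ Each $a_i$ is supported on $A$ and not reducible to $B$; each $b_j$ is supported on $B$ and not reducible to $A$; each $h_k$ is reducible to neither $A$ nor $B$. For each $\bar\sigma\in\{\bar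 X,\bar Y,\bar Z\}$, the operator $\bar\sigma'$ is supported on $A$ if $\bar\sigma$ is reducible to $A$, and on $B$ if $\bar\sigma$ is reducible to $B$ but not to $A$. 2. Exactly one of the following five cases occurs, with the stated subsystem magic: - (i) $\bar Z$ and $\bar Y$ are both reducible to $A$, and neither is reducible to $B$: $\tilde{\mathcal M}_2(\rho_A)=\log_2(4/3)$. - (ii) $\bar Z$ and $\bar Y$ are both reducible to $B$, and neither is reducible to $A$: $\tilde{\mathcal M}_2(\rho_A)=0$. - (iii) neither $\bar Z$ nor $\bar Y$ is reducible to $A$ or to $B$: $\tilde{\mathcal M}_2(\rho_A)=0$. - (iv) $\bar Z$ is reducible to $A$ and to $B$, and $\bar Y$ to neither: $\tilde{\mathcal M}_2(\rho_A)=\log_2(6/5)$. - (v) $\bar Y$ is reducible to $A$ and to $B$, and $\bar Z$ to neither: $\tilde{\mathcal M}_2(\rho_A)=\log_2(6/5)$. -/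

import Mathlib

open scoped BigOperators Matrix

noncomputable section

namespace MagicGauge

/-- Operators on the qubits labelled by `ι`, as matrices in the computational basis. -/
abbrev Op (ι : Type*) : Type _ := Matrix (ι → Fin 2) (ι → Fin 2) ℂ

/-- Labels of the four single-qubit Pauli matrices. -/
inductive Pauli
  | I
  | X
  | Y
  | Z
  deriving DecidableEq

instance : Fintype Pauli :=
  ⟨{Pauli.I, Pauli.X, Pauli.Y, Pauli.Z}, by intro p; cases p <;> simp⟩

/-- The single-qubit Pauli matrices. -/
def Pauli.mat : Pauli → Matrix (Fin 2) (Fin 2) ℂ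
  | Pauli.I => 1
  | Pauli.X => !![0, 1; 1, 0]
  | Pauli.Y => !![0, -Complex.I; Complex.I, 0]
  | Pauli.Z => !![1, 0; 0, -1]

section Qubits

variable {ι : Type*} [Fintype ι] [DecidableEq ι]

/-- The Pauli string with phase `+1`: the tensor product over all qubits `i` of the single-qubit
Pauli matrices `P i`. -/
def pauliString (P : ι → Pauli) : Op ι :=
  Matrix.of fun x y => ∏ i, (P i).mat (x i) (y i)

/-- `M` is a Hermitian Pauli operator, i.e. plus or minus a Pauli string. -/
def IsHermitianPauli (M : Op ι) : Prop :=
  ∃ P : ι → Pauli, M = pauliString P ∨ M = -pauliString P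

/-- `M` is a Hermitian Pauli operator that acts as the identity on every qubit outside `S`. -/
def SupportedOn (S : Finset ι) (M : Op ι) : Prop :=
  ∃ P : ι → Pauli, (∀ i, i ∉ S → P i = Pauli.I) ∧ (M = pauliString P ∨ M = -pauliString P)

/-- The group generated by the operators `g k`. The generators considered below are involutions,
hence the multiplicative submonoid that they generate is already a group. -/
def stabGroup {κ : Type*} (g : κ → Op ι) : Submonoid (Op ι) :=
  Submonoid.closure (Set.range g)

/-- The group generated by all the operators `g l` with `l ≠ k`. -/
def stabGroupExcept {κ : Type*} (g : κ → Op ι) (k : κ) : Submonoid (Op ι) :=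
  Submonoid.closure (g '' {l | l ≠ k})

/-- `g` is a family of independent generators of a stabilizer group: commuting, independent
Hermitian Pauli operators that do not generate `-1`. -/
structure IsStabilizerGenerators {κ : Type*} (g : κ → Op ι) : Prop where
  pauli : ∀ k, IsHermitianPauli (g k)
  comm : ∀ k l, g k * g l = g l * g k
  independent : ∀ k, g k ∉ stabGroupExcept g k
  neg_one_notMem : (-1 : Op ι) ∉ stabGroup g

/-- `X, Y, Z` are the logical Pauli operators of a logical qubit of the stabilizer code with
stabilizer group `G`: Hermitian Pauli operators that commute with every stabilizer, where `X` and
`Z` anticommute and `Y = i X Z`. (As they anticommute pairwise, none of them is in `G` or `-G`.) -/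
structure IsLogicalTriple (G : Submonoid (Op ι)) (X Y Z : Op ι) : Prop where
  pauli_X : IsHermitianPauli X
  pauli_Y : IsHermitianPauli Y
  pauli_Z : IsHermitianPauli Z
  comm_X : ∀ s ∈ G, X * s = s * X
  comm_Y : ∀ s ∈ G, Y * s = s * Y
  comm_Z : ∀ s ∈ G, Z * s = s * Z
  anticomm : X * Z = -(Z * X)
  Y_eq : Y = Complex.I • (X * Z)

/-- The logical operator `σ` can be reduced to `S`: some equivalent logical operator `σ * s`, with
`s` a stabilizer, is supported on `S`. -/
def LogicalReducible (G : Submonoid (Op ι)) (S : Finset ι) (σ : Op ι) : Prop :=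
  ∃ s ∈ G, SupportedOn S (σ * s)

/-- The generator `g k` can be reduced to `S`: its product with some element of the group generated
by the other generators is supported on `S`. -/
def GeneratorReducible {κ : Type*} (g : κ → Op ι) (S : Finset ι) (k : κ) : Prop :=
  ∃ s ∈ stabGroupExcept g k, SupportedOn S (g k * s)

/-- `σ'` is a representative of the logical operator `σ` modulo stabilizers that is supported on
`A` if `σ` can be reduced to `A`, and otherwise on the complement of `A` if `σ` can be reduced to
that complement. -/
def IsGaugeRepresentative (G : Submonoid (Op ι)) (A : Finset ι) (σ σ' : Op ι) : Prop :=
  (∃ s ∈ G, σ' = σ * s) ∧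
  (LogicalReducible G A σ → SupportedOn A σ') ∧
  (¬ LogicalReducible G A σ → LogicalReducible G Aᶜ σ → SupportedOn Aᶜ σ')

/-- The basis state of all qubits that is `x` on the qubits in `A` and `z` on the others. -/
def glue (A : Finset ι) (x : {i // i ∈ A} → Fin 2) (z : {i // i ∉ A} → Fin 2) : ι → Fin 2 :=
  fun i => if h : i ∈ A then x ⟨i, h⟩ else z ⟨i, h⟩

/-- The reduced density matrix on `A`: the partial trace of `ρ` over the complement of `A`. -/
def reducedState (A : Finset ι) (ρ : Op ι) : Op {i // i ∈ A} :=
  Matrix.of fun x y => ∑ z : {i // i ∉ A} → Fin 2, ρ (glue A x z) (glue A y z)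

/-- The (normalized) stabilizer 2-Rényi entropy of a density matrix,
`-log₂ (∑_P Tr[P ρ]⁴ / ∑_P Tr[P ρ]²)`, where `P` runs over all Pauli strings with phase `+1`. The
traces are real as `ρ` is Hermitian. -/
def magic (ρ : Op ι) : ℝ :=
  -Real.logb 2
    ((∑ P : ι → Pauli, (Matrix.trace (pauliString P * ρ)).re ^ 4) /
      (∑ P : ι → Pauli, (Matrix.trace (pauliString P * ρ)).re ^ 2))

end Qubits

end MagicGauge

end

open MagicGauge

noncomputable section

set_option linter.unusedSectionVars false

universe u

/-! Let `G` be the stabilizer group, `B` the complement of `A`, and `G_S` the subgroup of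
stabilizers supported on `S`.

Gauge. `G` is a vector space over the field with two elements. `G_A` and `G_B` meet trivially,
because a Pauli operator supported on both sides is `±1` and `-1 ∉ G`. Bases of `G_A`, of `G_B` and
of a complement of their sum give the generators `a`, `b`, `h` (`exists_adapted_generators`). If
some `h` were reducible to `A`, its reduced form would lie in `G_A`, which the `a` generate, against
independence. The state keeps its form because `∏ (1 + g_j) = ∑_{s ∈ G} s` depends on `G` alone and
absorbs stabilizers. Operators on disjoint sets commute, so anticommuting logical operators are
never reducible to complementary sets (`not_reducible_compl`). Once one logical operator is
reducible to `A`, the other two are not reducible to `B`, and representatives need to be chosen for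
one side only.

Magic. The cosets `G`, `ZG`, `YG` consist of distinct Pauli strings up to sign, on which `ρ` has
coefficients `±1`, `±w`, `±w` with `w = 1/√2`. If `r_S` of the operators `Z`, `Y` are reducible to
`S`, an even `f` vanishing at `0` sums over the strings on `S` to `|G_S| (f 1 + r_S f w)`. With
fourth and second powers, the magic is `log₂ ((1 + r_A/2) / (1 + r_A/4))`.

Five cases. The two reductions of a pure state have equal purity, so `2 + r_A` and `2 + r_B` agree
up to a power of two. Divisibility by 3 yields `r_A = 1 ↔ r_B = 1`. With the anticommutation
constraint, only five patterns survive. -/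

namespace MagicGauge

/-! ### Single-qubit Pauli algebra -/

/-- The product of two Pauli labels, up to phase. -/
def Pauli.mul : Pauli → Pauli → Pauli
  | .I, q => q
  | p, .I => p
  | .X, .X => .I
  | .Y, .Y => .I
  | .Z, .Z => .I
  | .X, .Y => .Z
  | .Y, .X => .Z
  | .Y, .Z => .X
  | .Z, .Y => .X
  | .Z, .X => .Y
  | .X, .Z => .Y

/-- The phase in the product of two Pauli matrices. -/
def Pauli.phase : Pauli → Pauli → ℂ
  | .X, .Y => Complex.I
  | .Y, .X => -Complex.I
  | .Y, .Z => Complex.I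
  | .Z, .Y => -Complex.I
  | .Z, .X => Complex.I
  | .X, .Z => -Complex.I
  | _, _ => 1

theorem Pauli.mat_mul_mat (p q : Pauli) : p.mat * q.mat = phase p q • (mul p q).mat := by
  cases p <;> cases q <;> ext i j <;> fin_cases i <;> fin_cases j <;>
    simp [Pauli.mat, Pauli.mul, Pauli.phase, Matrix.mul_apply]

theorem Pauli.mul_comm (p q : Pauli) : mul p q = mul q p := by
  cases p <;> cases q <;> rfl

theorem Pauli.mul_self (p : Pauli) : mul p p = .I := by
  cases p <;> rfl

theorem Pauli.mul_eq_I {p q : Pauli} : mul p q = .I ↔ p = q := by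
  cases p <;> cases q <;> simp [mul]

theorem Pauli.phase_self (p : Pauli) : phase p p = 1 := by
  cases p <;> rfl

theorem Pauli.phase_mul_phase (p q : Pauli) : phase p q * phase q p = 1 := by
  cases p <;> cases q <;> simp [phase]

theorem Pauli.phase_I_left (q : Pauli) : phase .I q = 1 := by
  cases q <;> rfl

theorem Pauli.phase_I_right (p : Pauli) : phase p .I = 1 := by
  cases p <;> rfl

theorem Pauli.trace_mat (p : Pauli) : Matrix.trace p.mat = if p = .I then 2 else 0 := by
  cases p <;> simp [mat, Matrix.trace]

/-! ### Pauli strings: products, trace orthogonality, supports -/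

section Qubits

variable {ι : Type*} [Fintype ι] [DecidableEq ι]

theorem pauliString_mul (P Q : ι → Pauli) :
    pauliString P * pauliString Q =
      (∏ i, Pauli.phase (P i) (Q i)) • pauliString fun i => Pauli.mul (P i) (Q i) := by
  ext x z
  simp only [Matrix.mul_apply, pauliString, Matrix.of_apply, Matrix.smul_apply, smul_eq_mul,
    ← Finset.prod_mul_distrib]
  rw [← Fintype.prod_sum fun i j => (P i).mat (x i) j * (Q i).mat j (z i)]
  refine Finset.prod_congr rfl fun i _ => ?_
  rw [← Matrix.mul_apply, Pauli.mat_mul_mat, Matrix.smul_apply, smul_eq_mul]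

theorem pauliString_I : pauliString (fun _ : ι => Pauli.I) = 1 := by
  ext x y
  simp only [pauliString, Matrix.of_apply, Pauli.mat, Matrix.one_apply]
  rw [Finset.prod_ite_zero]
  simp [funext_iff]

theorem trace_pauliString (P : ι → Pauli) :
    Matrix.trace (pauliString P) = if P = fun _ => Pauli.I then 2 ^ Fintype.card ι else 0 := by
  have h : Matrix.trace (pauliString P) = ∏ i, Matrix.trace (P i).mat := by
    simp only [Matrix.trace, pauliString, Matrix.of_apply, Matrix.diag_apply]
    rw [← Fintype.prod_sum fun i j => (P i).mat j j]
  simp only [h, Pauli.trace_mat, Finset.prod_ite_zero, funext_iff]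
  simp

theorem trace_pauliString_mul (P Q : ι → Pauli) :
    Matrix.trace (pauliString P * pauliString Q) = if P = Q then 2 ^ Fintype.card ι else 0 := by
  rw [pauliString_mul, Matrix.trace_smul, trace_pauliString]
  by_cases h : P = Q
  · subst h
    simp [Pauli.mul_self, Pauli.phase_self]
  · rw [if_neg h, if_neg, smul_zero]
    exact fun h' => h (funext fun i => Pauli.mul_eq_I.1 (congrFun h' i))

theorem pauliString_mul_self (P : ι → Pauli) : pauliString P * pauliString P = 1 := by
  rw [pauliString_mul]
  simp [Pauli.mul_self, Pauli.phase_self, pauliString_I]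

theorem eq_of_smul_pauliString_eq {P Q : ι → Pauli} {c d : ℂ} (hc : c ≠ 0)
    (h : c • pauliString P = d • pauliString Q) : P = Q := by
  by_contra hne
  have := congrArg (fun M => Matrix.trace (pauliString P * M)) h
  simp [trace_pauliString_mul, hne, hc] at this

theorem IsHermitianPauli.exists_smul {M : Op ι} (hM : IsHermitianPauli M) :
    ∃ (P : ι → Pauli) (c : ℂ), (c = 1 ∨ c = -1) ∧ M = c • pauliString P := by
  obtain ⟨P, h | h⟩ := hM
  · exact ⟨P, 1, Or.inl rfl, by simp [h]⟩
  · exact ⟨P, -1, Or.inr rfl, by simp [h]⟩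

theorem SupportedOn.exists_smul {S : Finset ι} {M : Op ι} (hM : SupportedOn S M) :
    ∃ (P : ι → Pauli) (c : ℂ), (∀ i, i ∉ S → P i = Pauli.I) ∧ (c = 1 ∨ c = -1) ∧
      M = c • pauliString P := by
  obtain ⟨P, hP, h | h⟩ := hM
  · exact ⟨P, 1, hP, Or.inl rfl, by simp [h]⟩
  · exact ⟨P, -1, hP, Or.inr rfl, by simp [h]⟩

theorem SupportedOn.isHermitianPauli {S : Finset ι} {M : Op ι} (hM : SupportedOn S M) :
    IsHermitianPauli M :=
  let ⟨P, _, h⟩ := hM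
  ⟨P, h⟩

theorem isHermitianPauli_smul {P : ι → Pauli} {c : ℂ} (hc : c = 1 ∨ c = -1) :
    IsHermitianPauli (c • pauliString P) := by
  rcases hc with rfl | rfl
  · exact ⟨P, Or.inl (one_smul _ _)⟩
  · exact ⟨P, Or.inr (by simp)⟩

theorem isHermitianPauli_one : IsHermitianPauli (1 : Op ι) :=
  ⟨fun _ => Pauli.I, Or.inl pauliString_I.symm⟩

theorem supportedOn_one (S : Finset ι) : SupportedOn S (1 : Op ι) :=
  ⟨fun _ => Pauli.I, fun _ _ => rfl, Or.inl pauliString_I.symm⟩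

theorem IsHermitianPauli.mul_self {M : Op ι} (hM : IsHermitianPauli M) : M * M = 1 := by
  obtain ⟨P, rfl | rfl⟩ := hM <;> simp [pauliString_mul_self]

/-- The product of two Pauli strings is a Pauli string up to a phase, which is inverted when the
factors are exchanged. -/
theorem exists_pauliString_mul (P Q : ι → Pauli) :
    ∃ c d : ℂ, c * d = 1 ∧
      pauliString P * pauliString Q = c • pauliString (fun i => Pauli.mul (P i) (Q i)) ∧
      pauliString Q * pauliString P = d • pauliString (fun i => Pauli.mul (P i) (Q i)) := by
  refine ⟨_, ∏ i, Pauli.phase (Q i) (P i), ?_, pauliString_mul P Q, ?_⟩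
  · simp [← Finset.prod_mul_distrib, Pauli.phase_mul_phase]
  · rw [pauliString_mul Q P]
    simp only [Pauli.mul_comm (Q _) (P _)]

theorem pauliString_ne_zero (P : ι → Pauli) : pauliString P ≠ 0 := by
  intro h
  have := trace_pauliString_mul P P
  rw [h, zero_mul, Matrix.trace_zero, if_pos rfl] at this
  exact pow_ne_zero _ two_ne_zero this.symm

/-- The phases of the two orders of multiplication are mutually inverse; commutation makes them
equal, hence `±1`. -/
theorem IsHermitianPauli.mul {M N : Op ι} (hM : IsHermitianPauli M) (hN : IsHermitianPauli N)
    (h : M * N = N * M) : IsHermitianPauli (M * N) := by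
  obtain ⟨P, a, ha, rfl⟩ := hM.exists_smul
  obtain ⟨Q, b, hb, rfl⟩ := hN.exists_smul
  obtain ⟨c, d, hcd, hc, hd⟩ := exists_pauliString_mul P Q
  simp only [Matrix.smul_mul, Matrix.mul_smul, hc, hd, smul_smul] at h ⊢
  have hab : a * b ≠ 0 := by rcases ha with rfl | rfl <;> rcases hb with rfl | rfl <;> simp
  have h' := smul_left_injective ℂ (pauliString_ne_zero fun i => (P i).mul (Q i)) h
  have hcd' : c = d := by
    apply mul_left_cancel₀ hab
    linear_combination h'
  subst hcd'
  apply isHermitianPauli_smul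
  rcases mul_self_eq_one_iff.1 hcd with rfl | rfl <;> rcases ha with rfl | rfl <;>
    rcases hb with rfl | rfl <;> simp

/-- Labels multiply qubit by qubit, so the product is trivial outside `S`. The scalar is there for
`Y = i X Z`, whose factors anticommute, so that `X Z` alone is not Hermitian. -/
theorem SupportedOn.smul_mul {S : Finset ι} {M N : Op ι} (hM : SupportedOn S M)
    (hN : SupportedOn S N) {c : ℂ} (h : IsHermitianPauli (c • (M * N))) :
    SupportedOn S (c • (M * N)) := by
  obtain ⟨P, a, hP, ha, rfl⟩ := hM.exists_smul
  obtain ⟨Q, b, hQ, hb, rfl⟩ := hN.exists_smul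
  obtain ⟨R, e, he, h⟩ := h.exists_smul
  have hR := h
  rw [Matrix.smul_mul, Matrix.mul_smul, pauliString_mul, smul_smul, smul_smul, smul_smul] at hR
  have hRe := eq_of_smul_pauliString_eq (by rcases he with rfl | rfl <;> simp) hR.symm
  rw [h]
  refine ⟨R, fun i hi => ?_, ?_⟩
  · simp [hRe, hP i hi, hQ i hi, Pauli.mul]
  · rcases he with rfl | rfl <;> simp

theorem SupportedOn.mul {S : Finset ι} {M N : Op ι} (hM : SupportedOn S M)
    (hN : SupportedOn S N) (h : M * N = N * M) : SupportedOn S (M * N) := by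
  have := hM.smul_mul hN (c := 1)
  rw [one_smul] at this
  exact this (hM.isHermitianPauli.mul hN.isHermitianPauli h)

theorem SupportedOn.commute_of_compl {S : Finset ι} {M N : Op ι} (hM : SupportedOn S M)
    (hN : SupportedOn Sᶜ N) : M * N = N * M := by
  obtain ⟨P, a, hP, ha, rfl⟩ := hM.exists_smul
  obtain ⟨Q, b, hQ, hb, rfl⟩ := hN.exists_smul
  have h : ∀ i, P i = .I ∨ Q i = .I := fun i => by
    by_cases hi : i ∈ S
    · exact Or.inr (hQ i (by simpa using hi))
    · exact Or.inl (hP i hi)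
  have h₁ : ∏ i, Pauli.phase (P i) (Q i) = 1 := Finset.prod_eq_one fun i _ => by
    rcases h i with h | h <;> simp [h, Pauli.phase_I_left, Pauli.phase_I_right]
  have h₂ : ∏ i, Pauli.phase (Q i) (P i) = 1 := Finset.prod_eq_one fun i _ => by
    rcases h i with h | h <;> simp [h, Pauli.phase_I_left, Pauli.phase_I_right]
  simp only [Matrix.smul_mul, Matrix.mul_smul, pauliString_mul, h₁, h₂,
    Pauli.mul_comm (Q _) (P _)]
  rw [smul_comm]

theorem SupportedOn.eq_one_or_neg_one {S : Finset ι} {M : Op ι} (hM : SupportedOn S M)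
    (hM' : SupportedOn Sᶜ M) : M = 1 ∨ M = -1 := by
  obtain ⟨P, a, hP, ha, rfl⟩ := hM.exists_smul
  obtain ⟨Q, b, hQ, hb, h⟩ := hM'.exists_smul
  obtain rfl := eq_of_smul_pauliString_eq (by rcases ha with rfl | rfl <;> simp) h
  have : P = fun _ => Pauli.I := funext fun i => by
    by_cases hi : i ∈ S
    · exact hQ i (by simpa using hi)
    · exact hP i hi
  rcases ha with rfl | rfl <;> simp [this, pauliString_I]

end Qubits

/-! ### Groups of commuting involutions as vector spaces over `ZMod 2` -/

section ElementaryAbelian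

variable {M : Type*} [Monoid M]

theorem commute_of_mem_closure {S : Set M} (comm : ∀ x ∈ S, ∀ y ∈ S, x * y = y * x) {x y : M}
    (hx : x ∈ Submonoid.closure S) (hy : y ∈ Submonoid.closure S) : x * y = y * x := by
  have h : ∀ z ∈ S, ∀ w ∈ Submonoid.closure S, Commute z w := fun z hz w hw => by
    induction hw using Submonoid.closure_induction with
    | mem w hw => exact comm z hz w hw
    | one => exact Commute.one_right z
    | mul a b _ _ ha hb => exact ha.mul_right hb
  have h' : Commute x y := by
    induction hx using Submonoid.closure_induction with
    | mem w hw => exact h w hw y hy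
    | one => exact Commute.one_left y
    | mul a b _ _ ha hb => exact ha.mul_left hb
  exact h'

theorem mul_self_of_mem_closure {S : Set M} (comm : ∀ x ∈ S, ∀ y ∈ S, x * y = y * x)
    (sq : ∀ x ∈ S, x * x = 1) {x : M} (hx : x ∈ Submonoid.closure S) : x * x = 1 := by
  induction hx using Submonoid.closure_induction with
  | mem w hw => exact sq w hw
  | one => exact one_mul 1
  | mul a b ha hb iha ihb =>
    rw [mul_assoc, ← mul_assoc b, commute_of_mem_closure comm hb ha, mul_assoc a b, ihb, mul_one,
      iha]

/-- A commutative submonoid consisting of involutions is a vector space over `ZMod 2`. -/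
theorem exists_zmod_two_module {M : Type u} [Monoid M] (G : Submonoid M)
    (comm : ∀ x ∈ G, ∀ y ∈ G, x * y = y * x) (sq : ∀ x ∈ G, x * x = 1) :
    ∃ (V : Type u) (_ : AddCommGroup V) (_ : Module (ZMod 2) V) (f : Multiplicative V →* M),
      Function.Injective f ∧ MonoidHom.mrange f = G := by
  let _ : CommGroup G :=
    { (inferInstance : Monoid G) with
      inv := id
      inv_mul_cancel := fun x => Subtype.ext (sq x x.2)
      mul_comm := fun x y => Subtype.ext (comm x x.2 y y.2) }
  let _ : Module (ZMod 2) (Additive G) := AddCommGroup.zmodModule (n := 2) fun x => by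
    rw [two_nsmul]
    exact congrArg Additive.ofMul (Subtype.ext (sq x.toMul x.toMul.2) : x.toMul * x.toMul = 1)
  refine ⟨Additive G, inferInstance, inferInstance,
    { toFun := fun v => (v.toAdd.toMul : M), map_one' := rfl, map_mul' := fun _ _ => rfl },
    fun v w h => Subtype.ext h, ?_⟩
  ext x
  constructor
  · rintro ⟨v, rfl⟩
    exact v.toAdd.toMul.2
  · exact fun hx => ⟨Multiplicative.ofAdd (Additive.ofMul ⟨x, hx⟩), rfl⟩

variable {V : Type*} [AddCommGroup V] [Module (ZMod 2) V] (f : Multiplicative V →* M)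

theorem mem_closure_image_iff {S : Set V} {x : M} :
    x ∈ Submonoid.closure ((fun v => f (Multiplicative.ofAdd v)) '' S) ↔
      ∃ v ∈ Submodule.span (ZMod 2) S, f (Multiplicative.ofAdd v) = x := by
  constructor
  · intro hx
    induction hx using Submonoid.closure_induction with
    | mem w hw =>
      obtain ⟨v, hv, rfl⟩ := hw
      exact ⟨v, Submodule.subset_span hv, rfl⟩
    | one => exact ⟨0, zero_mem _, map_one f⟩
    | mul a b ha hb iha ihb =>
      obtain ⟨v, hv, rfl⟩ := iha
      obtain ⟨w, hw, rfl⟩ := ihb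
      exact ⟨v + w, add_mem hv hw, by rw [ofAdd_add, map_mul]⟩
  · rintro ⟨v, hv, rfl⟩
    induction hv using Submodule.span_induction with
    | mem w hw => exact Submonoid.subset_closure ⟨w, hw, rfl⟩
    | zero => rw [ofAdd_zero, map_one]; exact one_mem _
    | add a b _ _ ha hb => rw [ofAdd_add, map_mul]; exact mul_mem ha hb
    | smul c a _ ha =>
      -- The only scalars are 0 and 1, so spans are no larger than multiplicative closures.
      obtain rfl | rfl : c = 0 ∨ c = 1 := by revert c; decide
      · rw [zero_smul, ofAdd_zero, map_one]; exact one_mem _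
      · rwa [one_smul]

variable {f}

/-- Dictionary between independence of generators and linear independence, which makes bases and
complements available. -/
theorem linearIndependent_iff_notMem_closure (hf : Function.Injective f) {κ : Type*} (v : κ → V) :
    LinearIndependent (ZMod 2) v ↔
      ∀ k, f (Multiplicative.ofAdd (v k)) ∉
        Submonoid.closure ((fun l => f (Multiplicative.ofAdd (v l))) '' {l | l ≠ k}) := by
  rw [linearIndependent_iff_notMem_span]
  refine forall_congr' fun k => not_congr ?_
  have : (fun l => f (Multiplicative.ofAdd (v l))) '' {l | l ≠ k} =
      (fun v => f (Multiplicative.ofAdd v)) '' (v '' (Set.univ \ {k})) := by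
    rw [Set.image_image]
    congr 1
    ext
    simp
  rw [this, mem_closure_image_iff]
  constructor
  · exact fun h => ⟨_, h, rfl⟩
  · rintro ⟨w, hw, h⟩
    rwa [← Multiplicative.ofAdd.injective (hf h)]

theorem closure_range_eq_map (f : Multiplicative V →* M) {κ : Type*} (v : κ → V) :
    (Submonoid.closure (Set.range fun k => f (Multiplicative.ofAdd (v k))) : Set M) =
      (fun v => f (Multiplicative.ofAdd v)) '' (Submodule.span (ZMod 2) (Set.range v) : Set V) := by
  ext x
  have := mem_closure_image_iff f (S := Set.range v) (x := x)
  rw [← Set.range_comp] at this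
  exact this

/-- Generators of an elementary abelian 2-group `⟨g⟩` that are adapted to two subgroups `H` and
`K` with trivial intersection. -/
theorem exists_adapted_generators {M : Type u} [Monoid M] {n : ℕ} (g : Fin n → M)
    (comm : ∀ k l, g k * g l = g l * g k) (sq : ∀ k, g k * g k = 1)
    (indep : ∀ k, g k ∉ Submonoid.closure (g '' {l | l ≠ k}))
    (H K : Submonoid M) (hH : H ≤ Submonoid.closure (Set.range g))
    (hK : K ≤ Submonoid.closure (Set.range g)) (hHK : ∀ x ∈ H, x ∈ K → x = 1) :
    ∃ (nA nB m : ℕ) (a : Fin nA → M) (b : Fin nB → M) (h : Fin m → M),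
      n = nA + nB + m ∧
      Submonoid.closure (Set.range (Sum.elim a (Sum.elim b h))) =
        Submonoid.closure (Set.range g) ∧
      (∀ k, Sum.elim a (Sum.elim b h) k ∉
        Submonoid.closure (Sum.elim a (Sum.elim b h) '' {l | l ≠ k})) ∧
      Submonoid.closure (Set.range a) = H ∧ Submonoid.closure (Set.range b) = K ∧
      Nat.card H = 2 ^ nA ∧ Nat.card K = 2 ^ nB ∧
      Nat.card (Submonoid.closure (Set.range g)) = 2 ^ n := by
  have comm' : ∀ x ∈ Set.range g, ∀ y ∈ Set.range g, x * y = y * x := by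
    rintro _ ⟨k, rfl⟩ _ ⟨l, rfl⟩
    exact comm k l
  have sq' : ∀ x ∈ Set.range g, x * x = 1 := by
    rintro _ ⟨k, rfl⟩
    exact sq k
  obtain ⟨V, _, _, f, hf, hfG⟩ := exists_zmod_two_module (Submonoid.closure (Set.range g))
    (fun x hx y hy => commute_of_mem_closure comm' hx hy)
    (fun x hx => mul_self_of_mem_closure comm' sq' hx)
  let F : V → M := fun v => f (Multiplicative.ofAdd v)
  have hF : Function.Injective F := hf.comp Multiplicative.ofAdd.injective
  have hFrange : ∀ x, x ∈ Submonoid.closure (Set.range g) ↔ ∃ v, F v = x := fun x => by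
    rw [← hfG]
    exact Iff.rfl
  have hg : ∀ k, ∃ v, F v = g k := fun k => (hFrange _).1 (Submonoid.subset_closure ⟨k, rfl⟩)
  choose v hv using hg
  obtain rfl : (fun k => F (v k)) = g := funext hv
  have hvli : LinearIndependent (ZMod 2) v := (linearIndependent_iff_notMem_closure hf v).2 indep
  have hvspan : ⊤ ≤ Submodule.span (ZMod 2) (Set.range v) := fun w _ => by
    have h₁ := (hFrange (F w)).2 ⟨w, rfl⟩
    rw [← SetLike.mem_coe, closure_range_eq_map] at h₁
    obtain ⟨w', hw', h⟩ := h₁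
    rwa [← hF h]
  let B := Module.Basis.mk hvli hvspan
  have _ : Module.Finite (ZMod 2) V := Module.Finite.of_basis B
  have hrank : Module.finrank (ZMod 2) V = n := by
    rw [Module.finrank_eq_card_basis B, Fintype.card_fin]
  -- Over `ZMod 2` closure under addition suffices for a subspace: `-x = x`, and the scalars are 0
  -- and 1.
  have hsub : ∀ N : Submonoid M, N ≤ Submonoid.closure (Set.range fun k => F (v k)) →
      ∃ (W : Submodule (ZMod 2) V), F '' W = N := fun N hN => by
    refine ⟨AddSubgroup.toZModSubmodule 2 (AddSubgroup.mk (AddSubmonoid.mk (AddSubsemigroup.mk {w | F w ∈ N} ?_) ?_) ?_), ?_⟩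
    · intro a b ha hb
      change f _ ∈ N
      rw [ofAdd_add, map_mul]
      exact mul_mem ha hb
    · change f _ ∈ N
      rw [ofAdd_zero, map_one]
      exact one_mem _
    · intro x hx
      have : -x = x := by
        rw [← neg_one_smul (ZMod 2) x, show (-1 : ZMod 2) = 1 from rfl, one_smul]
      change -x ∈ _
      rw [this]
      exact hx
    · ext x
      constructor
      · rintro ⟨w, hw, rfl⟩
        exact hw
      · intro hx
        obtain ⟨w, rfl⟩ := (hFrange x).1 (hN hx)
        exact ⟨w, hx, rfl⟩
  have hcard : ∀ (N : Submonoid M) (W : Submodule (ZMod 2) V), F '' W = N →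
      Nat.card N = 2 ^ Module.finrank (ZMod 2) W := fun N W h => by
    have h₁ : Nat.card N = Nat.card W := by
      change Nat.card (N : Set M) = Nat.card (W : Set V)
      rw [← Nat.card_image_of_injective hF (W : Set V), h]
    rw [h₁, Module.natCard_eq_pow_finrank (K := ZMod 2)]
    simp
  obtain ⟨WH, hWH⟩ := hsub H hH
  obtain ⟨WK, hWK⟩ := hsub K hK
  have hdisj : Disjoint WH WK := by
    rw [Submodule.disjoint_def]
    intro x hx hx'
    have h₁ : F x ∈ H := by
      rw [← SetLike.mem_coe, ← hWH]
      exact ⟨x, hx, rfl⟩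
    have h₂ : F x ∈ K := by
      rw [← SetLike.mem_coe, ← hWK]
      exact ⟨x, hx', rfl⟩
    apply hF
    rw [hHK _ h₁ h₂]
    exact (map_one f).symm
  -- A basis of this complement supplies the generators `h`, those on neither side.
  obtain ⟨W, hW⟩ := (WH ⊔ WK).exists_isCompl
  let bA := Module.finBasis (ZMod 2) WH
  let bB := Module.finBasis (ZMod 2) WK
  let bC := Module.finBasis (ZMod 2) W
  have hspan : ∀ {r : ℕ} {U : Submodule (ZMod 2) V} (b : Module.Basis (Fin r) (ZMod 2) U),
      Submodule.span (ZMod 2) (Set.range fun i => (b i : V)) = U := fun {r U} b => by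
    have := congrArg (Submodule.map U.subtype) b.span_eq
    rw [Submodule.map_span, Submodule.map_top, Submodule.range_subtype, ← Set.range_comp] at this
    exact this
  have hli : ∀ {r : ℕ} {U : Submodule (ZMod 2) V} (b : Module.Basis (Fin r) (ZMod 2) U),
      LinearIndependent (ZMod 2) (fun i => (b i : V)) := fun {r U} b =>
    b.linearIndependent.map' U.subtype (Submodule.ker_subtype U)
  have hliAB : LinearIndependent (ZMod 2)
      (Sum.elim (fun i => (bA i : V)) (Sum.elim (fun i => (bB i : V)) fun i => (bC i : V))) := by
    refine (hli bA).sum_type ((hli bB).sum_type (hli bC) ?_) ?_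
    · rw [hspan, hspan]
      exact hW.disjoint.mono_left le_sup_right
    · rw [Set.Sum.elim_range, Submodule.span_union, hspan, hspan, hspan]
      exact hdisj.disjoint_sup_right_of_disjoint_sup_left hW.disjoint
  have hspanAB : Submodule.span (ZMod 2) (Set.range
      (Sum.elim (fun i => (bA i : V)) (Sum.elim (fun i => (bB i : V)) fun i => (bC i : V)))) = ⊤ := by
    rw [Set.Sum.elim_range, Set.Sum.elim_range, Submodule.span_union, Submodule.span_union,
      hspan, hspan, hspan, ← sup_assoc]
    exact hW.sup_eq_top
  have hgen : Sum.elim (fun i => F (bA i)) (Sum.elim (fun i => F (bB i)) fun i => F (bC i)) =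
      fun k => F (Sum.elim (fun i => (bA i : V))
        (Sum.elim (fun i => (bB i : V)) fun i => (bC i : V)) k) := by
    ext k
    rcases k with k | k | k <;> rfl
  refine ⟨_, _, _, fun i => F (bA i), fun i => F (bB i), fun i => F (bC i), ?_, ?_, ?_, ?_, ?_,
    hcard H WH hWH, hcard K WK hWK, ?_⟩
  · rw [← hrank, Module.finrank_eq_card_basis (Module.Basis.mk hliAB hspanAB.ge)]
    simp [add_assoc]
  · rw [hgen]
    apply SetLike.coe_injective
    rw [closure_range_eq_map, closure_range_eq_map, hspanAB, eq_top_iff.2 hvspan]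
  · rw [hgen]
    exact (linearIndependent_iff_notMem_closure hf _).1 hliAB
  · apply SetLike.coe_injective
    rw [closure_range_eq_map, hspan]
    exact hWH
  · apply SetLike.coe_injective
    rw [closure_range_eq_map, hspan]
    exact hWK
  · rw [hcard _ ⊤, finrank_top, hrank]
    rw [closure_range_eq_map, eq_top_iff.2 hvspan]

end ElementaryAbelian

/-! ### The product of the factors `1 + g` as a sum over the group -/

section Projector

variable {R : Type*} [Ring R]

/-- The factor belonging to `x` absorbs it, since `x (1 + x) = 1 + x`. -/
theorem mul_prod_one_add_of_mem {l : List R} (comm : ∀ x ∈ l, ∀ y ∈ l, x * y = y * x)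
    (sq : ∀ x ∈ l, x * x = 1) {x : R} (hx : x ∈ l) :
    x * (l.map (1 + ·)).prod = (l.map (1 + ·)).prod := by
  induction l with
  | nil => simp at hx
  | cons y t ih =>
    rw [List.map_cons, List.prod_cons, ← mul_assoc]
    rcases List.mem_cons.1 hx with rfl | hx'
    · rw [mul_add, mul_one, sq x hx, add_comm]
    · rw [mul_add, mul_one, comm x hx y (by simp), ← one_add_mul, mul_assoc,
        ih (fun a ha b hb => comm a (by simp [ha]) b (by simp [hb]))
          (fun a ha => sq a (by simp [ha])) hx']

theorem mul_prod_one_add_of_mem_closure {l : List R} (comm : ∀ x ∈ l, ∀ y ∈ l, x * y = y * x)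
    (sq : ∀ x ∈ l, x * x = 1) {x : R} (hx : x ∈ Submonoid.closure {y | y ∈ l}) :
    x * (l.map (1 + ·)).prod = (l.map (1 + ·)).prod := by
  induction hx using Submonoid.closure_induction with
  | mem x hx => exact mul_prod_one_add_of_mem comm sq hx
  | one => exact one_mul _
  | mul a b _ _ ha hb => rw [mul_assoc, hb, ha]

theorem sum_mul_of_mem (G : Submonoid R) [Fintype G] {x : R} (hx : x ∈ G) (sq : x * x = 1) :
    (∑ s : G, (s : R)) * x = ∑ s : G, (s : R) := by
  rw [Finset.sum_mul]
  refine Fintype.sum_bijective (fun s : G => s * ⟨x, hx⟩) ?_ _ _ fun s => rfl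
  have h : Function.Involutive fun s : G => s * ⟨x, hx⟩ := fun s => Subtype.ext <| by
    simp [mul_assoc, sq]
  exact h.bijective

theorem sum_mul_prod_one_add (G : Submonoid R) [Fintype G] {l : List R} (hl : ∀ x ∈ l, x ∈ G)
    (sq : ∀ x ∈ l, x * x = 1) :
    (∑ s : G, (s : R)) * (l.map (1 + ·)).prod = 2 ^ l.length * ∑ s : G, (s : R) := by
  induction l with
  | nil => simp
  | cons y t ih =>
    rw [List.map_cons, List.prod_cons, ← mul_assoc, mul_add, mul_one,
      sum_mul_of_mem G (hl y (by simp)) (sq y (by simp)), ← two_mul, mul_assoc,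
      ih (fun x hx => hl x (by simp [hx])) (fun x hx => sq x (by simp [hx])), ← mul_assoc,
      List.length_cons, pow_succ']

/-- For independent commuting involutions generating `G`, the product of all `1 + g` is the sum of
the elements of `G`. -/
theorem prod_one_add_eq_sum [Algebra ℂ R] {G : Submonoid R} [Fintype G] {l : List R}
    (hG : Submonoid.closure {x | x ∈ l} = G) (comm : ∀ x ∈ l, ∀ y ∈ l, x * y = y * x)
    (sq : ∀ x ∈ l, x * x = 1) (card : Nat.card G = 2 ^ l.length) :
    (l.map (1 + ·)).prod = ∑ s : G, (s : R) := by
  -- The product of the group sum and `∏ (1 + g)` is evaluated twice: every group element is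
  -- absorbed by the product, giving `|G| ∏ (1 + g)`, and every factor acts on the group sum as 2.
  -- Independence enters only through `|G| = 2 ^ l.length`.
  have h₁ : (∑ s : G, (s : R)) * (l.map (1 + ·)).prod =
      (2 ^ l.length : ℂ) • (l.map (1 + ·)).prod := by
    rw [Finset.sum_mul, Finset.sum_congr rfl fun s _ =>
      mul_prod_one_add_of_mem_closure comm sq (hG ▸ s.2), Finset.sum_const, Finset.card_univ,
      ← Nat.card_eq_fintype_card, card, ← Nat.cast_smul_eq_nsmul ℂ]
    push_cast
    rfl
  have h₂ := sum_mul_prod_one_add G (fun x hx => hG ▸ Submonoid.subset_closure hx) sq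
  have h₃ : (2 ^ l.length : R) = algebraMap ℂ R (2 ^ l.length) := by rw [map_pow, map_ofNat]
  rw [h₁, h₃, ← Algebra.smul_def] at h₂
  exact smul_right_injective R (pow_ne_zero l.length (two_ne_zero' ℂ)) h₂

theorem prod_ofFn_smul [Algebra ℂ R] (c : ℂ) {n : ℕ} (f : Fin n → R) :
    (List.ofFn fun i => c • f i).prod = c ^ n • (List.ofFn f).prod := by
  induction n with
  | zero => simp
  | succ n ih =>
    rw [List.ofFn_succ, List.ofFn_succ, List.prod_cons, List.prod_cons, ih, smul_mul_smul_comm,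
      pow_succ']

end Projector

/-! ### Stabilizer groups and generators adapted to a bipartition -/

section Stabilizers

variable {ι κ : Type*} [Fintype ι] [DecidableEq ι] {g : κ → Op ι}

theorem IsStabilizerGenerators.commute (hg : IsStabilizerGenerators g) {s t : Op ι}
    (hs : s ∈ stabGroup g) (ht : t ∈ stabGroup g) : s * t = t * s := by
  refine commute_of_mem_closure ?_ hs ht
  rintro _ ⟨k, rfl⟩ _ ⟨l, rfl⟩
  exact hg.comm k l

theorem IsStabilizerGenerators.isHermitianPauli (hg : IsStabilizerGenerators g) {s : Op ι}
    (hs : s ∈ stabGroup g) : IsHermitianPauli s := by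
  induction hs using Submonoid.closure_induction with
  | mem w hw =>
    obtain ⟨k, rfl⟩ := hw
    exact hg.pauli k
  | one => exact isHermitianPauli_one
  | mul a b ha hb iha ihb => exact iha.mul ihb (hg.commute ha hb)

theorem IsStabilizerGenerators.mul_self (hg : IsStabilizerGenerators g) {s : Op ι}
    (hs : s ∈ stabGroup g) : s * s = 1 :=
  (hg.isHermitianPauli hs).mul_self

/-- The stabilizers that are supported on `S`. -/
def IsStabilizerGenerators.supported (hg : IsStabilizerGenerators g) (S : Finset ι) :
    Submonoid (Op ι) where
  carrier := {s | s ∈ stabGroup g ∧ SupportedOn S s}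
  one_mem' := ⟨one_mem _, supportedOn_one S⟩
  mul_mem' ha hb := ⟨mul_mem ha.1 hb.1, ha.2.mul hb.2 (hg.commute ha.1 hb.1)⟩

theorem IsStabilizerGenerators.eq_one_of_supported (hg : IsStabilizerGenerators g) {S : Finset ι}
    {s : Op ι} (hs : s ∈ hg.supported S) (hs' : s ∈ hg.supported Sᶜ) : s = 1 := by
  rcases hs.2.eq_one_or_neg_one hs'.2 with h | h
  · exact h
  · exact absurd (h ▸ hs.1) hg.neg_one_notMem

/-- Independent generators of a stabilizer group adapted to the bipartition `S`, `Sᶜ`. -/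
theorem IsStabilizerGenerators.exists_bipartite {n : ℕ} {g : Fin n → Op ι}
    (hg : IsStabilizerGenerators g) (S : Finset ι) :
    ∃ (nA nB m : ℕ) (a : Fin nA → Op ι) (b : Fin nB → Op ι) (h : Fin m → Op ι),
      n = nA + nB + m ∧
      IsStabilizerGenerators (Sum.elim a (Sum.elim b h)) ∧
      stabGroup (Sum.elim a (Sum.elim b h)) = stabGroup g ∧
      (∀ i, SupportedOn S (a i) ∧
        ¬ GeneratorReducible (Sum.elim a (Sum.elim b h)) Sᶜ (Sum.inl i)) ∧
      (∀ j, SupportedOn Sᶜ (b j) ∧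
        ¬ GeneratorReducible (Sum.elim a (Sum.elim b h)) S (Sum.inr (Sum.inl j))) ∧
      (∀ k, ¬ GeneratorReducible (Sum.elim a (Sum.elim b h)) S (Sum.inr (Sum.inr k)) ∧
        ¬ GeneratorReducible (Sum.elim a (Sum.elim b h)) Sᶜ (Sum.inr (Sum.inr k))) ∧
      Nat.card (hg.supported S) = 2 ^ nA ∧ Nat.card (hg.supported Sᶜ) = 2 ^ nB ∧
      Nat.card (stabGroup g) = 2 ^ n := by
  obtain ⟨nA, nB, m, a, b, h, hn, hcl, hind, hA, hB, cA, cB, cG⟩ :=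
    exists_adapted_generators g hg.comm (fun k => (hg.pauli k).mul_self) hg.independent
      (hg.supported S) (hg.supported Sᶜ) (fun _ hs => hs.1) (fun _ hs => hs.1)
      (fun _ hs hs' => hg.eq_one_of_supported hs hs')
  have hmem : ∀ k, Sum.elim a (Sum.elim b h) k ∈ stabGroup g := fun k => by
    rw [stabGroup, ← hcl]
    exact Submonoid.subset_closure ⟨k, rfl⟩
  have hexc : ∀ k, ∀ s ∈ stabGroupExcept (Sum.elim a (Sum.elim b h)) k, s ∈ stabGroup g :=
    fun k s hs => by
      rw [stabGroup, ← hcl]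
      exact Submonoid.closure_mono (Set.image_subset_range _ _) hs
  -- A reduced form of generator `k` is a stabilizer supported on `T`. If the other generators
  -- already produce all of these, they produce generator `k` itself, against independence.
  have hred : ∀ (T : Finset ι) (k), hg.supported T ≤
      stabGroupExcept (Sum.elim a (Sum.elim b h)) k →
      ¬ GeneratorReducible (Sum.elim a (Sum.elim b h)) T k := by
    rintro T k hT ⟨s, hs, hks⟩
    apply hind k
    have h₁ := hT ⟨mul_mem (hmem k) (hexc k s hs), hks⟩
    have h₂ : Sum.elim a (Sum.elim b h) k = Sum.elim a (Sum.elim b h) k * s * s := by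
      rw [mul_assoc, hg.mul_self (hexc k s hs), mul_one]
    rw [h₂]
    exact mul_mem h₁ hs
  have hAle : ∀ k, (∀ i, k ≠ Sum.inl i) →
      hg.supported S ≤ stabGroupExcept (Sum.elim a (Sum.elim b h)) k := fun k hk => by
    rw [← hA, Submonoid.closure_le]
    rintro _ ⟨i, rfl⟩
    exact Submonoid.subset_closure ⟨Sum.inl i, (hk i).symm, rfl⟩
  have hBle : ∀ k, (∀ j, k ≠ Sum.inr (Sum.inl j)) →
      hg.supported Sᶜ ≤ stabGroupExcept (Sum.elim a (Sum.elim b h)) k := fun k hk => by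
    rw [← hB, Submonoid.closure_le]
    rintro _ ⟨j, rfl⟩
    exact Submonoid.subset_closure ⟨Sum.inr (Sum.inl j), (hk j).symm, rfl⟩
  refine ⟨nA, nB, m, a, b, h, hn, ⟨fun k => hg.isHermitianPauli (hmem k),
    fun k l => hg.commute (hmem k) (hmem l), hind, ?_⟩, hcl, fun i => ⟨?_, ?_⟩,
    fun j => ⟨?_, ?_⟩, fun k => ⟨?_, ?_⟩, cA, cB, cG⟩
  · rw [stabGroup, hcl]
    exact hg.neg_one_notMem
  · have : a i ∈ hg.supported S := hA ▸ Submonoid.subset_closure ⟨i, rfl⟩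
    exact this.2
  · exact hred _ _ (hBle _ (by simp))
  · have : b j ∈ hg.supported Sᶜ := hB ▸ Submonoid.subset_closure ⟨j, rfl⟩
    exact this.2
  · exact hred _ _ (hAle _ (by simp))
  · exact hred _ _ (hAle _ (by simp))
  · exact hred _ _ (hBle _ (by simp))

theorem IsStabilizerGenerators.prod_eq_sum {n : ℕ} {g : Fin n → Op ι}
    (hg : IsStabilizerGenerators g) [Fintype (stabGroup g)] :
    (List.ofFn fun j => 1 + g j).prod = ∑ s : stabGroup g, (s : Op ι) := by
  -- The bipartition is irrelevant here; only the order of the group is extracted.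
  obtain ⟨-, -, -, -, -, -, -, -, -, -, -, -, -, -, card⟩ := hg.exists_bipartite ∅
  have h := prod_one_add_eq_sum (G := stabGroup g) (l := List.ofFn g) ?_ ?_ ?_ ?_
  · rw [← h, List.map_ofFn]
    rfl
  · simp only [List.mem_ofFn']
    rfl
  · simp only [List.mem_ofFn']
    rintro _ ⟨k, rfl⟩ _ ⟨l, rfl⟩
    exact hg.comm k l
  · simp only [List.mem_ofFn']
    rintro _ ⟨k, rfl⟩
    exact (hg.pauli k).mul_self
  · rw [card, List.length_ofFn]

theorem IsStabilizerGenerators.prod_mul_prod_mul_prod_eq_sum {nA nB m : ℕ} {a : Fin nA → Op ι}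
    {b : Fin nB → Op ι} {h : Fin m → Op ι} {G : Submonoid (Op ι)} [Fintype G]
    (hg : IsStabilizerGenerators (Sum.elim a (Sum.elim b h)))
    (hG : stabGroup (Sum.elim a (Sum.elim b h)) = G) (card : Nat.card G = 2 ^ (nA + nB + m)) :
    (List.ofFn fun i => 1 + a i).prod * (List.ofFn fun j => 1 + b j).prod *
      (List.ofFn fun k => 1 + h k).prod = ∑ s : G, (s : Op ι) := by
  have hmem : ∀ x, x ∈ List.ofFn a ++ List.ofFn b ++ List.ofFn h ↔
      x ∈ Set.range (Sum.elim a (Sum.elim b h)) := fun x => by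
    simp only [List.mem_append, List.mem_ofFn', Set.Sum.elim_range, Set.mem_union, or_assoc]
  have key := prod_one_add_eq_sum (G := G) (l := List.ofFn a ++ List.ofFn b ++ List.ofFn h)
    ?_ ?_ ?_ ?_
  · rw [← key, List.map_append, List.map_append, List.prod_append, List.prod_append,
      List.map_ofFn, List.map_ofFn, List.map_ofFn]
    rfl
  · simp only [hmem]
    exact hG
  · simp only [hmem]
    rintro _ ⟨k, rfl⟩ _ ⟨l, rfl⟩
    exact hg.comm k l
  · simp only [hmem]
    rintro _ ⟨k, rfl⟩
    exact (hg.pauli k).mul_self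
  · rw [card, List.length_append, List.length_append, List.length_ofFn, List.length_ofFn,
      List.length_ofFn]

end Stabilizers

/-! ### Logical operators and their gauge representatives -/

section Gauge

variable {ι κ : Type*} [Fintype ι] [DecidableEq ι] {g : κ → Op ι} {X Y Z : Op ι}

/-- Anticommuting logical operators cannot be reduced to complementary sets. -/
theorem IsStabilizerGenerators.not_reducible_compl (hg : IsStabilizerGenerators g) {σ τ : Op ι}
    (pσ : IsHermitianPauli σ) (pτ : IsHermitianPauli τ)
    (hσ : ∀ s ∈ stabGroup g, σ * s = s * σ) (hτ : ∀ s ∈ stabGroup g, τ * s = s * τ)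
    (anti : σ * τ = -(τ * σ)) {S : Finset ι} (h₁ : LogicalReducible (stabGroup g) S σ) :
    ¬ LogicalReducible (stabGroup g) Sᶜ τ := by
  rintro ⟨t, ht, hτt⟩
  obtain ⟨s, hs, hσs⟩ := h₁
  have h := hσs.commute_of_compl hτt
  -- The reduced operators commute, while `σ` and `τ` anticommute and stabilizers commute with
  -- everything present. So `τ σ t s` equals its own negative and vanishes, although it is
  -- invertible.
  rw [Commute.mul_mul_mul_comm (hτ _ hs).symm, Commute.mul_mul_mul_comm (hσ _ ht).symm, anti, hg.commute hs ht, neg_mul,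
    neg_eq_iff_add_eq_zero, ← two_smul ℂ, smul_eq_zero_iff_right two_ne_zero] at h
  have h' : τ * σ * (t * s) * ((t * s) * (σ * τ)) = 0 := by rw [h, zero_mul]
  rw [← mul_assoc, mul_assoc (τ * σ), hg.mul_self (mul_mem ht hs), mul_one, mul_assoc τ,
    ← mul_assoc σ, pσ.mul_self, one_mul, pτ.mul_self] at h'
  exact one_ne_zero h'

namespace IsLogicalTriple

variable {G : Submonoid (Op ι)}

theorem X_mul_Y (h : IsLogicalTriple G X Y Z) : X * Y = Complex.I • Z := by
  rw [h.Y_eq, Matrix.mul_smul, ← mul_assoc, h.pauli_X.mul_self, one_mul]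

theorem Y_mul_Z (h : IsLogicalTriple G X Y Z) : Y * Z = Complex.I • X := by
  rw [h.Y_eq, Matrix.smul_mul, mul_assoc, h.pauli_Z.mul_self, mul_one]

theorem Y_mul_X (h : IsLogicalTriple G X Y Z) : Y * X = -(X * Y) := by
  rw [h.X_mul_Y, h.Y_eq, Matrix.smul_mul, mul_assoc, ← neg_eq_iff_eq_neg.2 h.anticomm, mul_neg,
    ← mul_assoc, h.pauli_X.mul_self, one_mul, smul_neg]

theorem Z_mul_Y (h : IsLogicalTriple G X Y Z) : Z * Y = -(Y * Z) := by
  rw [h.Y_mul_Z, h.Y_eq, Matrix.mul_smul, ← mul_assoc, ← neg_eq_iff_eq_neg.2 h.anticomm, neg_mul,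
    mul_assoc, h.pauli_Z.mul_self, mul_one, smul_neg]

/-- The stabilizers for `X` and `Z` are free; `Y = i X Z` then forces `s * t` for `Y`. -/
theorem mul_stabilizers (hg : IsStabilizerGenerators g)
    (h : IsLogicalTriple (stabGroup g) X Y Z) {s t : Op ι} (hs : s ∈ stabGroup g)
    (ht : t ∈ stabGroup g) :
    IsLogicalTriple (stabGroup g) (X * s) (Y * (s * t)) (Z * t) where
  pauli_X := h.pauli_X.mul (hg.isHermitianPauli hs) (h.comm_X s hs)
  pauli_Y := h.pauli_Y.mul (hg.isHermitianPauli (mul_mem hs ht)) (h.comm_Y _ (mul_mem hs ht))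
  pauli_Z := h.pauli_Z.mul (hg.isHermitianPauli ht) (h.comm_Z t ht)
  comm_X u hu := by rw [mul_assoc, hg.commute hs hu, ← mul_assoc, h.comm_X u hu, mul_assoc]
  comm_Y u hu := by
    rw [mul_assoc, hg.commute (mul_mem hs ht) hu, ← mul_assoc, h.comm_Y u hu, mul_assoc]
  comm_Z u hu := by rw [mul_assoc, hg.commute ht hu, ← mul_assoc, h.comm_Z u hu, mul_assoc]
  anticomm := by
    rw [Commute.mul_mul_mul_comm (h.comm_Z _ hs).symm, Commute.mul_mul_mul_comm (h.comm_X _ ht).symm, h.anticomm,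
      hg.commute hs ht, neg_mul]
  Y_eq := by rw [Commute.mul_mul_mul_comm (h.comm_Z _ hs).symm, h.Y_eq, Matrix.smul_mul]

/-- Logical operators that are supported on `S` whenever they are reducible to `S`. -/
theorem exists_supported_representatives (hg : IsStabilizerGenerators g)
    (h : IsLogicalTriple (stabGroup g) X Y Z) (S : Finset ι) :
    ∃ s ∈ stabGroup g, ∃ t ∈ stabGroup g,
      (LogicalReducible (stabGroup g) S X → SupportedOn S (X * s)) ∧
      (LogicalReducible (stabGroup g) S Y → SupportedOn S (Y * (s * t))) ∧
      (LogicalReducible (stabGroup g) S Z → SupportedOn S (Z * t)) := by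
  have pauli : ∀ {σ s : Op ι}, IsHermitianPauli σ → (∀ s ∈ stabGroup g, σ * s = s * σ) →
      s ∈ stabGroup g → IsHermitianPauli (σ * s) := fun pσ hσ hs =>
    pσ.mul (hg.isHermitianPauli hs) (hσ _ hs)
  -- If two of the operators are supported on `S`, so is the third, being their product up to a
  -- phase.
  have third : ∀ {σ τ υ s t : Op ι} {c : ℂ}, υ = c • (σ * τ) →
      (∀ s ∈ stabGroup g, τ * s = s * τ) → s ∈ stabGroup g →
      IsHermitianPauli (υ * (s * t)) → SupportedOn S (σ * s) → SupportedOn S (τ * t) →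
      SupportedOn S (υ * (s * t)) := fun hυ hτ hs pυ h₁ h₂ => by
    rw [hυ, Matrix.smul_mul, ← Commute.mul_mul_mul_comm (hτ _ hs).symm] at pυ ⊢
    exact h₁.smul_mul h₂ pυ
  by_cases hX : LogicalReducible (stabGroup g) S X
  · obtain ⟨s, hs, hXs⟩ := hX
    by_cases hZ : LogicalReducible (stabGroup g) S Z
    · obtain ⟨t, ht, hZt⟩ := hZ
      exact ⟨s, hs, t, ht, fun _ => hXs, fun _ => third h.Y_eq h.comm_Z hs
        (pauli h.pauli_Y h.comm_Y (mul_mem hs ht)) hXs hZt, fun _ => hZt⟩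
    by_cases hY : LogicalReducible (stabGroup g) S Y
    · obtain ⟨u, hu, hYu⟩ := hY
      -- The choice `t = s * u` makes the correction of `Y` equal to `u`, because `s * s = 1`.
      refine ⟨s, hs, s * u, mul_mem hs hu, fun _ => hXs, fun _ => ?_, fun h => absurd h hZ⟩
      rwa [← mul_assoc s, hg.mul_self hs, one_mul]
    · exact ⟨s, hs, 1, one_mem _, fun _ => hXs, fun h => absurd h hY, fun h => absurd h hZ⟩
  by_cases hZ : LogicalReducible (stabGroup g) S Z
  · obtain ⟨t, ht, hZt⟩ := hZ
    by_cases hY : LogicalReducible (stabGroup g) S Y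
    · obtain ⟨u, hu, hYu⟩ := hY
      refine ⟨u * t, mul_mem hu ht, t, ht, fun h => absurd h hX, fun _ => ?_, fun _ => hZt⟩
      rwa [mul_assoc u, hg.mul_self ht, mul_one]
    · exact ⟨1, one_mem _, t, ht, fun h => absurd h hX, fun h => absurd h hY, fun _ => hZt⟩
  by_cases hY : LogicalReducible (stabGroup g) S Y
  · obtain ⟨u, hu, hYu⟩ := hY
    refine ⟨u, hu, 1, one_mem _, fun h => absurd h hX, fun _ => ?_, fun h => absurd h hZ⟩
    rwa [mul_one]
  · exact ⟨1, one_mem _, 1, one_mem _, fun h => absurd h hX, fun h => absurd h hY,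
      fun h => absurd h hZ⟩

theorem exists_gauge_representatives (hg : IsStabilizerGenerators g)
    (h : IsLogicalTriple (stabGroup g) X Y Z) (A : Finset ι) :
    ∃ s ∈ stabGroup g, ∃ t ∈ stabGroup g,
      IsGaugeRepresentative (stabGroup g) A X (X * s) ∧
      IsGaugeRepresentative (stabGroup g) A Y (Y * (s * t)) ∧
      IsGaugeRepresentative (stabGroup g) A Z (Z * t) := by
  have hXZ := fun r => hg.not_reducible_compl h.pauli_X h.pauli_Z h.comm_X h.comm_Z h.anticomm
    (S := A) r
  have hZX := fun r => hg.not_reducible_compl h.pauli_Z h.pauli_X h.comm_Z h.comm_X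
    (neg_eq_iff_eq_neg.2 h.anticomm).symm (S := A) r
  have hYX := fun r => hg.not_reducible_compl h.pauli_Y h.pauli_X h.comm_Y h.comm_X h.Y_mul_X
    (S := A) r
  have hXY := fun r => hg.not_reducible_compl h.pauli_X h.pauli_Y h.comm_X h.comm_Y
    (neg_eq_iff_eq_neg.2 h.Y_mul_X).symm (S := A) r
  have hZY := fun r => hg.not_reducible_compl h.pauli_Z h.pauli_Y h.comm_Z h.comm_Y h.Z_mul_Y
    (S := A) r
  have hYZ := fun r => hg.not_reducible_compl h.pauli_Y h.pauli_Z h.comm_Y h.comm_Z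
    (neg_eq_iff_eq_neg.2 h.Z_mul_Y).symm (S := A) r
  -- If some operator is reducible to `A`, the other two anticommute with it and cannot be reducible
  -- to the complement, so representatives adapted to `A` suffice. Otherwise only the complement
  -- matters.
  by_cases hA : LogicalReducible (stabGroup g) A X ∨ LogicalReducible (stabGroup g) A Y ∨
    LogicalReducible (stabGroup g) A Z
  · obtain ⟨s, hs, t, ht, h₁, h₂, h₃⟩ := h.exists_supported_representatives hg A
    refine ⟨s, hs, t, ht, ⟨⟨s, hs, rfl⟩, h₁, fun hn hr => ?_⟩,
      ⟨⟨s * t, mul_mem hs ht, rfl⟩, h₂, fun hn hr => ?_⟩, ⟨⟨t, ht, rfl⟩, h₃, fun hn hr => ?_⟩⟩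
    · rcases hA with hA | hA | hA
      exacts [absurd hA hn, absurd hr (hYX hA), absurd hr (hZX hA)]
    · rcases hA with hA | hA | hA
      exacts [absurd hr (hXY hA), absurd hA hn, absurd hr (hZY hA)]
    · rcases hA with hA | hA | hA
      exacts [absurd hr (hXZ hA), absurd hr (hYZ hA), absurd hA hn]
  · obtain ⟨s, hs, t, ht, h₁, h₂, h₃⟩ := h.exists_supported_representatives hg Aᶜ
    exact ⟨s, hs, t, ht, ⟨⟨s, hs, rfl⟩, fun r => absurd (Or.inl r) hA, fun _ => h₁⟩,
      ⟨⟨s * t, mul_mem hs ht, rfl⟩, fun r => absurd (Or.inr (Or.inl r)) hA, fun _ => h₂⟩,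
      ⟨⟨t, ht, rfl⟩, fun r => absurd (Or.inr (Or.inr r)) hA, fun _ => h₃⟩⟩

end IsLogicalTriple

end Gauge

/-! ### Partial traces and equality of complementary purities -/

section Traces

variable {ι : Type*} [Fintype ι] [DecidableEq ι]

/-- The Pauli strings supported on `S`. -/
def supportedStrings (S : Finset ι) : Finset (ι → Pauli) :=
  Fintype.piFinset fun i => if i ∈ S then Finset.univ else {Pauli.I}

theorem mem_supportedStrings {S : Finset ι} {P : ι → Pauli} :
    P ∈ supportedStrings S ↔ ∀ i, i ∉ S → P i = Pauli.I := by
  rw [supportedStrings, Fintype.mem_piFinset]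
  refine forall_congr' fun i => ?_
  by_cases hi : i ∈ S <;> simp [hi]

/-- In tensor form, `∑ p ⊗ p` is twice the swap operator; the purity identity rests on this. -/
theorem Pauli.sum_mat_mul_mat (x y z w : Fin 2) :
    ∑ p : Pauli, p.mat x y * p.mat z w = if x = w ∧ y = z then 2 else 0 := by
  have h : (Finset.univ : Finset Pauli) = {.I, .X, .Y, .Z} := rfl
  rw [h]
  fin_cases x <;> fin_cases y <;> fin_cases z <;> fin_cases w <;>
    simp [Pauli.mat, one_add_one_eq_two]

theorem sum_supportedStrings_mul (S : Finset ι) (x y z w : ι → Fin 2) :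
    ∑ Q ∈ supportedStrings S, pauliString Q x y * pauliString Q z w =
      ∏ i, if i ∈ S then (if x i = w i ∧ y i = z i then 2 else 0)
        else if x i = y i ∧ z i = w i then (1 : ℂ) else 0 := by
  simp only [pauliString, Matrix.of_apply, ← Finset.prod_mul_distrib]
  rw [supportedStrings, ← Finset.prod_univ_sum _ fun i p => Pauli.mat p (x i) (y i) * p.mat (z i) (w i)]
  refine Finset.prod_congr rfl fun i _ => ?_
  by_cases hi : i ∈ S
  · rw [if_pos hi, if_pos hi, Pauli.sum_mat_mul_mat]
  · rw [if_neg hi, if_neg hi, Finset.sum_singleton, Pauli.mat, Matrix.one_apply, Matrix.one_apply]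
    by_cases h : x i = y i <;> by_cases h' : z i = w i <;> simp [h, h']

/-- Exchanging `y` and `w` maps the sum over the Pauli strings on `S` to the one over the Pauli
strings on the complement. -/
theorem sum_supportedStrings_compl_mul (S : Finset ι) (x y z w : ι → Fin 2) :
    2 ^ Sᶜ.card * ∑ Q ∈ supportedStrings S, pauliString Q x y * pauliString Q z w =
      2 ^ S.card * ∑ Q ∈ supportedStrings Sᶜ, pauliString Q x w * pauliString Q z y := by
  have hpow : ∀ T : Finset ι, (2 : ℂ) ^ T.card = ∏ i, if i ∈ T then 2 else 1 := fun T => by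
    simp
  rw [sum_supportedStrings_mul, sum_supportedStrings_mul, hpow, hpow, ← Finset.prod_mul_distrib,
    ← Finset.prod_mul_distrib]
  refine Finset.prod_congr rfl fun i _ => ?_
  by_cases hi : i ∈ S
  · simp [hi, eq_comm]
  · simp [hi, eq_comm]

theorem trace_mul_vecMulVec_sq (M : Op ι) (u v : (ι → Fin 2) → ℂ) :
    Matrix.trace (M * Matrix.vecMulVec u v) ^ 2 =
      ∑ x, ∑ z, ∑ y, ∑ w, M x y * M z w * (u y * v x * (u w * v z)) := by
  simp only [Matrix.trace, Matrix.diag_apply, Matrix.mul_apply, Matrix.vecMulVec_apply, sq,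
    Finset.sum_mul_sum]
  refine Finset.sum_congr rfl fun x _ => Finset.sum_congr rfl fun z _ =>
    Finset.sum_congr rfl fun y _ => Finset.sum_congr rfl fun w _ => ?_
  ring

/-- The purities of the reductions of a rank-one operator to complementary sets agree. -/
theorem sum_trace_sq_compl (S : Finset ι) (u v : (ι → Fin 2) → ℂ) :
    2 ^ Sᶜ.card * ∑ Q ∈ supportedStrings S,
        Matrix.trace (pauliString Q * Matrix.vecMulVec u v) ^ 2 =
      2 ^ S.card * ∑ Q ∈ supportedStrings Sᶜ,
        Matrix.trace (pauliString Q * Matrix.vecMulVec u v) ^ 2 := by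
  have h : ∀ T : Finset ι, ∑ Q ∈ supportedStrings T,
        Matrix.trace (pauliString Q * Matrix.vecMulVec u v) ^ 2 =
      ∑ x, ∑ z, ∑ y, ∑ w, (∑ Q ∈ supportedStrings T, pauliString Q x y * pauliString Q z w) *
        (u y * v x * (u w * v z)) := fun T => by
    simp only [trace_mul_vecMulVec_sq, Finset.sum_mul]
    rw [Finset.sum_comm]
    refine Finset.sum_congr rfl fun x _ => ?_
    rw [Finset.sum_comm]
    refine Finset.sum_congr rfl fun z _ => ?_
    rw [Finset.sum_comm]
    refine Finset.sum_congr rfl fun y _ => ?_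
    rw [Finset.sum_comm]
  rw [h, h, Finset.mul_sum, Finset.mul_sum]
  refine Finset.sum_congr rfl fun x _ => ?_
  rw [Finset.mul_sum, Finset.mul_sum]
  refine Finset.sum_congr rfl fun z _ => ?_
  -- The weight `u y * v x * (u w * v z)` is symmetric in `y` and `w`, a consequence of rank one, so
  -- these indices may be exchanged on one side.
  conv_rhs => rw [Finset.sum_comm]
  rw [Finset.mul_sum, Finset.mul_sum]
  refine Finset.sum_congr rfl fun y _ => ?_
  rw [Finset.mul_sum, Finset.mul_sum]
  refine Finset.sum_congr rfl fun w _ => ?_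
  rw [← mul_assoc, ← mul_assoc, sum_supportedStrings_compl_mul]
  ring

/-- The Pauli string on all qubits that extends a Pauli string on `A` by the identity. -/
def extendString (A : Finset ι) (P : {i // i ∈ A} → Pauli) : ι → Pauli :=
  fun i => if h : i ∈ A then P ⟨i, h⟩ else Pauli.I

theorem pauliString_extendString_glue (A : Finset ι) (P : {i // i ∈ A} → Pauli)
    (x y : {i // i ∈ A} → Fin 2) (z w : {i // i ∉ A} → Fin 2) :
    pauliString (extendString A P) (glue A x z) (glue A y w) =
      if z = w then pauliString P x y else 0 := by
  have h : pauliString (extendString A P) (glue A x z) (glue A y w) =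
      pauliString P x y * pauliString (fun _ => Pauli.I) z w := by
    simp only [pauliString, Matrix.of_apply]
    let F : ι → ℂ := fun i => (extendString A P i).mat (glue A x z i) (glue A y w i)
    have e₁ : ∏ i : {i // i ∈ A}, (P i).mat (x i) (y i) = ∏ i : {i // i ∈ A}, F i :=
      Finset.prod_congr rfl fun i _ => by simp [F, extendString, glue]
    have e₂ : ∏ i : {i // i ∉ A}, Pauli.I.mat (z i) (w i) = ∏ i : {i // i ∉ A}, F i :=
      Finset.prod_congr rfl fun i _ => by simp [F, extendString, glue, i.2]
    rw [e₁, e₂]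
    convert (Fintype.prod_subtype_mul_prod_subtype (fun i => i ∈ A) F).symm
  rw [h, pauliString_I, Matrix.one_apply]
  split_ifs <;> simp

theorem sum_glue (A : Finset ι) (f : (ι → Fin 2) → ℂ) :
    ∑ x, f x = ∑ x : {i // i ∈ A} → Fin 2, ∑ z : {i // i ∉ A} → Fin 2, f (glue A x z) := by
  rw [← Fintype.sum_prod_type']
  exact ((Equiv.piEquivPiSubtypeProd (fun i => i ∈ A) fun _ => Fin 2).symm.sum_comp f).symm

/-- The partial trace is dual to extension by the identity. -/
theorem trace_pauliString_mul_reducedState (A : Finset ι) (P : {i // i ∈ A} → Pauli) (ρ : Op ι) :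
    Matrix.trace (pauliString P * reducedState A ρ) =
      Matrix.trace (pauliString (extendString A P) * ρ) := by
  simp only [Matrix.trace, Matrix.diag_apply, Matrix.mul_apply]
  rw [sum_glue A]
  refine Finset.sum_congr rfl fun x _ => ?_
  simp only [sum_glue A (fun j => pauliString (extendString A P) _ j * ρ j _),
    pauliString_extendString_glue, ite_mul, zero_mul, Finset.sum_ite_eq, Finset.mem_univ, if_true,
    reducedState, Matrix.of_apply, Finset.mul_sum]
  rw [Finset.sum_comm]

theorem sum_reducedState (A : Finset ι) (ρ : Op ι) (f : ℂ → ℝ) :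
    ∑ P, f (Matrix.trace (pauliString P * reducedState A ρ)) =
      ∑ Q ∈ supportedStrings A, f (Matrix.trace (pauliString Q * ρ)) := by
  refine Finset.sum_bij' (fun P _ => extendString A P) (fun Q _ i => Q i) (fun P _ => ?_)
    (fun _ _ => Finset.mem_univ _) (fun P _ => ?_) (fun Q hQ => ?_) fun P _ => ?_
  · exact mem_supportedStrings.2 fun i hi => dif_neg hi
  · ext i
    exact dif_pos i.2
  · funext i
    by_cases hi : i ∈ A
    · exact dif_pos hi
    · rw [mem_supportedStrings.1 hQ i hi]
      exact dif_neg hi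
  · rw [trace_pauliString_mul_reducedState]

end Traces

/-! ### Pauli coefficients of the state -/

section Magic

variable {ι κ : Type*} [Fintype ι] [DecidableEq ι] {g : κ → Op ι} {X Y Z : Op ι}

theorem supportedOn_smul_pauliString_iff {S : Finset ι} {P : ι → Pauli} {c : ℂ}
    (hc : c = 1 ∨ c = -1) :
    SupportedOn S (c • pauliString P) ↔ P ∈ supportedStrings S := by
  rw [mem_supportedStrings]
  constructor
  · intro h
    obtain ⟨Q, d, hQ, -, h⟩ := h.exists_smul
    rwa [eq_of_smul_pauliString_eq (by rcases hc with rfl | rfl <;> simp) h]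
  · rintro h
    exact ⟨P, h, by rcases hc with rfl | rfl <;> simp⟩

/-- By injectivity each inner sum has at most one nonzero term, so `f` passes through it. -/
theorem sum_apply_sum_ite {K α : Type*} [Fintype K] [DecidableEq α] {P : K → α}
    (hP : Function.Injective P) (c : K → ℝ) (S : Finset α) (f : ℝ → ℝ) (hf : f 0 = 0) :
    ∑ Q ∈ S, f (∑ k, if P k = Q then c k else 0) = ∑ k, if P k ∈ S then f (c k) else 0 := by
  classical
  have h : ∀ Q, f (∑ k, if P k = Q then c k else 0) = ∑ k, if P k = Q then f (c k) else 0 :=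
    fun Q => by
      by_cases hQ : ∃ k, P k = Q
      · obtain ⟨k, rfl⟩ := hQ
        simp [hP.eq_iff]
      · rw [Finset.sum_eq_zero, Finset.sum_eq_zero, hf] <;>
          exact fun k _ => if_neg fun h => hQ ⟨k, h⟩
  simp only [h]
  rw [Finset.sum_comm]
  simp

/-- The elements of `σ G` are distinct Pauli strings up to sign. -/
theorem IsStabilizerGenerators.exists_labels (hg : IsStabilizerGenerators g) {σ : Op ι}
    (pσ : IsHermitianPauli σ) (hσ : ∀ s ∈ stabGroup g, σ * s = s * σ) :
    ∃ (P : stabGroup g → ι → Pauli) (c : stabGroup g → ℝ), (∀ s, c s = 1 ∨ c s = -1) ∧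
      Function.Injective P ∧ ∀ s : stabGroup g, σ * (s : Op ι) = (c s : ℂ) • pauliString (P s) := by
  have h : ∀ s : stabGroup g, ∃ (P : ι → Pauli) (c : ℝ), (c = 1 ∨ c = -1) ∧
      σ * (s : Op ι) = (c : ℂ) • pauliString P := fun s => by
    obtain ⟨P, h | h⟩ := pσ.mul (hg.isHermitianPauli s.2) (hσ s s.2)
    · exact ⟨P, 1, Or.inl rfl, by simp [h]⟩
    · exact ⟨P, -1, Or.inr rfl, by simp [h]⟩
  choose P c hc hP using h
  refine ⟨P, c, hc, fun s t hst => ?_, hP⟩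
  have h₁ : (c s : ℂ) • (σ * (t : Op ι)) = (c t : ℂ) • (σ * (s : Op ι)) := by
    rw [hP, hP, hst, smul_comm]
  have h₂ : ∀ u : stabGroup g, σ * (σ * (u : Op ι)) = u := fun u => by
    rw [← mul_assoc, pσ.mul_self, one_mul]
  have h₃ := congrArg (fun M => σ * M) h₁
  simp only [Matrix.mul_smul, h₂] at h₃
  -- Equal labels force `s = ±t`; the minus sign would give `s * t = -1` in the group.
  have h₄ : (s : Op ι) = t ∨ (s : Op ι) = -t := by
    rcases hc s with e | e <;> rcases hc t with e' | e' <;> simp only [e, e'] at h₃ <;>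
      simp at h₃ <;> simp [h₃]
  rcases h₄ with h | h
  · exact Subtype.ext h
  · refine absurd ?_ hg.neg_one_notMem
    have h₅ : (-1 : Op ι) = s * t := by rw [h, neg_mul, hg.mul_self t.2]
    rw [h₅]
    exact mul_mem s.2 t.2

open Classical in
-- If `σ * t` is supported on `S`, multiplication by `t` matches the supported elements of `σ G`
-- with the stabilizers supported on `S`.
theorem IsStabilizerGenerators.sum_supportedOn (hg : IsStabilizerGenerators g)
    [Fintype (stabGroup g)] {σ : Op ι} (pσ : IsHermitianPauli σ)
    (hσ : ∀ s ∈ stabGroup g, σ * s = s * σ) (S : Finset ι) (r : ℝ) :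
    (∑ s : stabGroup g, if SupportedOn S (σ * (s : Op ι)) then r else 0) =
      if LogicalReducible (stabGroup g) S σ then Nat.card (hg.supported S) * r else 0 := by
  have hcard : (∑ s : stabGroup g, if SupportedOn S (s : Op ι) then r else 0) =
      Nat.card (hg.supported S) * r := by
    rw [← Finset.sum_filter, Finset.sum_const, nsmul_eq_mul, ← Fintype.card_subtype,
      ← Nat.card_eq_fintype_card]
    congr 2
    exact Nat.card_congr
      (Equiv.subtypeSubtypeEquivSubtypeInter (fun s => s ∈ stabGroup g) fun s => SupportedOn S s)
  split_ifs with h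
  · obtain ⟨t, ht, hσt⟩ := h
    have hinv : Function.Involutive fun s : stabGroup g => ⟨t, ht⟩ * s := fun s =>
      Subtype.ext <| by simp [← mul_assoc, hg.mul_self ht]
    rw [← hcard]
    refine Fintype.sum_bijective (fun s : stabGroup g => ⟨t, ht⟩ * s) hinv.bijective _ _
      fun s => ?_
    have hprod : σ * t * (σ * s) = t * s := by
      rw [Commute.mul_mul_mul_comm (hσ _ ht).symm, pσ.mul_self, one_mul]
    have hiff : SupportedOn S (σ * (s : Op ι)) ↔ SupportedOn S (t * (s : Op ι)) := by
      have hcomm : ∀ a ∈ stabGroup g, σ * t * a = a * (σ * t) := fun a ha => by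
        rw [mul_assoc, hg.commute ht ha, ← mul_assoc, hσ a ha, mul_assoc]
      constructor
      · intro hs
        rw [← hprod]
        refine hσt.mul hs ?_
        rw [hprod, Commute.mul_mul_mul_comm (hσ _ s.2).symm, pσ.mul_self, one_mul,
          hg.commute ht s.2]
      · intro hs
        have h₁ : σ * (s : Op ι) = σ * t * (t * s) := by
          rw [mul_assoc σ, ← mul_assoc t, hg.mul_self ht, one_mul]
        rw [h₁]
        exact hσt.mul hs (hcomm _ (mul_mem ht s.2))
    simp only [hiff]
    rfl
  · refine Finset.sum_eq_zero fun s _ => if_neg fun hs => h ⟨s, s.2, hs⟩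

/-- The Pauli coefficients of a state with one unit of magic are real, and the sum of an even
function of those on `S` only depends on which logical operators are reducible to `S`. -/
theorem IsLogicalTriple.sum_trace (hg : IsStabilizerGenerators g) [Fintype (stabGroup g)]
    (h : IsLogicalTriple (stabGroup g) X Y Z) {ρ : Op ι} {w : ℝ}
    (hρ : ρ = ((1 / 2 ^ Fintype.card ι : ℝ) : ℂ) •
      ((1 + (w : ℂ) • (Z - Y)) * ∑ s : stabGroup g, (s : Op ι))) :
    (∀ Q, (Matrix.trace (pauliString Q * ρ)).im = 0) ∧
    ∀ (S : Finset ι) (f : ℝ → ℝ), f 0 = 0 → (∀ x, f (-x) = f x) →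
      ∑ Q ∈ supportedStrings S, f (Matrix.trace (pauliString Q * ρ)).re =
        Nat.card (hg.supported S) * f 1 +
        open Classical in
        ((if LogicalReducible (stabGroup g) S Z then Nat.card (hg.supported S) * f w else 0) +
        (if LogicalReducible (stabGroup g) S Y then Nat.card (hg.supported S) * f w else 0)) := by
  classical
  have p1 : IsHermitianPauli (1 : Op ι) := isHermitianPauli_one
  have c1 : ∀ s ∈ stabGroup g, (1 : Op ι) * s = s * 1 := fun s _ => by rw [one_mul, mul_one]
  obtain ⟨P₁, c₁, hc₁, hi₁, h₁⟩ := hg.exists_labels p1 c1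
  obtain ⟨P₂, c₂, hc₂, hi₂, h₂⟩ := hg.exists_labels h.pauli_Z h.comm_Z
  obtain ⟨P₃, c₃, hc₃, hi₃, h₃⟩ := hg.exists_labels h.pauli_Y h.comm_Y
  -- Two cosets share no label when some `υ` commutes with one and anticommutes with the other. The
  -- separating operator is `Y` for `G` and `ZG`, and `Z` for the two pairs involving `YG`.
  have hne : ∀ {σ τ υ : Op ι} {P P' : stabGroup g → ι → Pauli} {c c' : stabGroup g → ℝ},
      (∀ s, c s = 1 ∨ c s = -1) →
      (∀ s : stabGroup g, σ * (s : Op ι) = (c s : ℂ) • pauliString (P s)) →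
      (∀ s : stabGroup g, τ * (s : Op ι) = (c' s : ℂ) • pauliString (P' s)) →
      (∀ s ∈ stabGroup g, υ * s = s * υ) → IsHermitianPauli υ → IsHermitianPauli τ →
      υ * σ = σ * υ → υ * τ = -(τ * υ) →
      ∀ s t, P s ≠ P' t := by
    intro σ τ υ P P' c c' hc hP hP' hυ pυ pτ hσ hτ s t hst
    have e₁ : (c' t : ℂ) • (σ * (s : Op ι)) = (c s : ℂ) • (τ * (t : Op ι)) := by
      rw [hP, hP', hst, smul_comm]
    have e₂ : υ * (σ * (s : Op ι)) = σ * s * υ := by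
      rw [← mul_assoc, hσ, mul_assoc, hυ s s.2, mul_assoc]
    have e₃ : υ * (τ * (t : Op ι)) = -(τ * t * υ) := by
      rw [← mul_assoc, hτ, neg_mul, mul_assoc, hυ t t.2, mul_assoc]
    have e₄ : (c s : ℂ) • (υ * (τ * (t : Op ι))) = (c s : ℂ) • (τ * t * υ) := by
      rw [← Matrix.mul_smul, ← e₁, Matrix.mul_smul, e₂, ← Matrix.smul_mul, e₁, Matrix.smul_mul]
    have e₅ := smul_right_injective (Op ι)
      (by rcases hc s with e | e <;> simp [e] : (c s : ℂ) ≠ 0) e₄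
    rw [e₃, neg_eq_iff_add_eq_zero, ← two_smul ℂ, smul_eq_zero_iff_right two_ne_zero] at e₅
    have e₆ : τ * (τ * t * υ * υ) * t = 0 := by rw [e₅]; simp
    rw [mul_assoc _ υ, pυ.mul_self, mul_one, ← mul_assoc, pτ.mul_self, one_mul,
      hg.mul_self t.2] at e₆
    exact one_ne_zero e₆
  have d₁₂ := hne hc₁ h₁ h₂ h.comm_Y h.pauli_Y h.pauli_Z (by simp)
    (neg_eq_iff_eq_neg.2 h.Z_mul_Y).symm
  have d₁₃ := hne hc₁ h₁ h₃ h.comm_Z h.pauli_Z h.pauli_Y (by simp) h.Z_mul_Y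
  have d₂₃ := hne hc₂ h₂ h₃ h.comm_Z h.pauli_Z h.pauli_Y rfl h.Z_mul_Y
  let P : stabGroup g ⊕ stabGroup g ⊕ stabGroup g → ι → Pauli := Sum.elim P₁ (Sum.elim P₂ P₃)
  let c : stabGroup g ⊕ stabGroup g ⊕ stabGroup g → ℝ :=
    Sum.elim c₁ (Sum.elim (fun s => w * c₂ s) fun s => -(w * c₃ s))
  have hP : Function.Injective P :=
    hi₁.sumElim (hi₂.sumElim hi₃ d₂₃) fun s t => by
      rcases t with t | t
      exacts [d₁₂ s t, d₁₃ s t]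
  have htr : ∀ {σ : Op ι} {P : stabGroup g → ι → Pauli} {c : stabGroup g → ℝ},
      (∀ s : stabGroup g, σ * (s : Op ι) = (c s : ℂ) • pauliString (P s)) → ∀ Q,
      Matrix.trace (pauliString Q * (σ * ∑ s : stabGroup g, (s : Op ι))) =
        2 ^ Fintype.card ι * ((∑ s, if P s = Q then c s else 0 : ℝ) : ℂ) := by
    intro σ P c hP Q
    rw [Finset.mul_sum, Finset.mul_sum, Matrix.trace_sum, Complex.ofReal_sum, Finset.mul_sum]
    refine Finset.sum_congr rfl fun s _ => ?_
    rw [hP, Matrix.mul_smul, Matrix.trace_smul, trace_pauliString_mul, smul_eq_mul]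
    by_cases hQ : P s = Q
    · rw [if_pos hQ, if_pos hQ.symm, mul_comm]
    · rw [if_neg hQ, if_neg (Ne.symm hQ)]
      simp
  have htrace : ∀ Q, Matrix.trace (pauliString Q * ρ) =
      ((∑ k, if P k = Q then c k else 0 : ℝ) : ℂ) := fun Q => by
    have e : ρ = ((1 / 2 ^ Fintype.card ι : ℝ) : ℂ) •
        (1 * (∑ s : stabGroup g, (s : Op ι)) + ((w : ℂ) • (Z * ∑ s : stabGroup g, (s : Op ι)) -
          (w : ℂ) • (Y * ∑ s : stabGroup g, (s : Op ι)))) := by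
      rw [hρ, add_mul, Matrix.smul_mul, sub_mul, smul_sub]
    rw [e, Matrix.mul_smul, Matrix.trace_smul, Matrix.mul_add, Matrix.mul_sub, Matrix.mul_smul,
      Matrix.mul_smul, Matrix.trace_add, Matrix.trace_sub, Matrix.trace_smul, Matrix.trace_smul,
      htr h₁, htr h₂, htr h₃, Fintype.sum_sum_type, Fintype.sum_sum_type]
    have e₂ : ∑ s, (if P (Sum.inr (Sum.inl s)) = Q then c (Sum.inr (Sum.inl s)) else 0) =
        w * ∑ s, if P₂ s = Q then c₂ s else 0 := by
      rw [Finset.mul_sum]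
      refine Finset.sum_congr rfl fun s _ => ?_
      by_cases hQ : P₂ s = Q <;> simp [P, c, hQ]
    have e₃ : ∑ s, (if P (Sum.inr (Sum.inr s)) = Q then c (Sum.inr (Sum.inr s)) else 0) =
        -(w * ∑ s, if P₃ s = Q then c₃ s else 0) := by
      rw [Finset.mul_sum, ← Finset.sum_neg_distrib]
      refine Finset.sum_congr rfl fun s _ => ?_
      by_cases hQ : P₃ s = Q <;> simp [P, c, hQ]
    have e₁ : ∑ s, (if P (Sum.inl s) = Q then c (Sum.inl s) else 0) =
        ∑ s, if P₁ s = Q then c₁ s else 0 := rfl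
    rw [e₁, e₂, e₃]
    generalize (∑ s, if P₁ s = Q then c₁ s else 0) = r₁
    generalize (∑ s, if P₂ s = Q then c₂ s else 0) = r₂
    generalize (∑ s, if P₃ s = Q then c₃ s else 0) = r₃
    simp only [smul_eq_mul]
    push_cast
    field_simp
    ring
  refine ⟨fun Q => by rw [htrace, Complex.ofReal_im], fun S f hf hf' => ?_⟩
  have hmem : ∀ {σ : Op ι} {P : stabGroup g → ι → Pauli} {c : stabGroup g → ℝ},
      (∀ s, c s = 1 ∨ c s = -1) →
      (∀ s : stabGroup g, σ * (s : Op ι) = (c s : ℂ) • pauliString (P s)) →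
      ∀ s, P s ∈ supportedStrings S ↔ SupportedOn S (σ * (s : Op ι)) := fun hc hP s => by
    rw [hP, supportedOn_smul_pauliString_iff]
    rcases hc s with e | e <;> simp [e]
  simp only [htrace, Complex.ofReal_re]
  rw [sum_apply_sum_ite hP c _ f hf, Fintype.sum_sum_type, Fintype.sum_sum_type,
    ← hg.sum_supportedOn h.pauli_Z h.comm_Z, ← hg.sum_supportedOn h.pauli_Y h.comm_Y]
  have e₁ := hg.sum_supportedOn p1 c1 S (f 1)
  rw [if_pos ⟨1, one_mem _, by rw [one_mul]; exact supportedOn_one S⟩] at e₁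
  rw [← e₁]
  -- The signs of the coefficients disappear because `f` is even.
  congr 1
  · refine Finset.sum_congr rfl fun s _ => ?_
    simp only [P, c, Sum.elim_inl, hmem hc₁ h₁]
    rcases hc₁ s with e | e <;> rw [e]
    rw [hf']
  · congr 1
    · refine Finset.sum_congr rfl fun s _ => ?_
      simp only [P, c, Sum.elim_inl, Sum.elim_inr, hmem hc₂ h₂]
      rcases hc₂ s with e | e <;> rw [e]
      · rw [mul_one]
      · rw [mul_neg_one, hf']
    · refine Finset.sum_congr rfl fun s _ => ?_
      simp only [P, c, Sum.elim_inr, hmem hc₃ h₃]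
      rcases hc₃ s with e | e <;> rw [e]
      · rw [mul_one, hf']
      · rw [mul_neg_one, neg_neg]

end Magic

/-! ### Subsystem magic and the parity constraint between the two sides -/

section Cases

variable {ι κ : Type*} [Fintype ι] [DecidableEq ι] {g : κ → Op ι} {X Y Z : Op ι}

open Classical in
/-- The number of the logical operators `Z` and `Y` that are reducible to `S`. -/
def reducibleCount (G : Submonoid (Op ι)) (S : Finset ι) (Y Z : Op ι) : ℕ :=
  (if LogicalReducible G S Z then 1 else 0) + (if LogicalReducible G S Y then 1 else 0)

theorem IsLogicalTriple.sum_trace_eq (hg : IsStabilizerGenerators g) [Fintype (stabGroup g)]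
    (h : IsLogicalTriple (stabGroup g) X Y Z) {ρ : Op ι} {w : ℝ}
    (hρ : ρ = ((1 / 2 ^ Fintype.card ι : ℝ) : ℂ) •
      ((1 + (w : ℂ) • (Z - Y)) * ∑ s : stabGroup g, (s : Op ι)))
    (S : Finset ι) (f : ℝ → ℝ) (hf : f 0 = 0) (hf' : ∀ x, f (-x) = f x) :
    ∑ Q ∈ supportedStrings S, f (Matrix.trace (pauliString Q * ρ)).re =
      Nat.card (hg.supported S) * (f 1 + reducibleCount (stabGroup g) S Y Z * f w) := by
  rw [(h.sum_trace hg hρ).2 S f hf hf', reducibleCount]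
  split_ifs <;> push_cast <;> ring

/-- The order of the local stabilizer group cancels in the quotient; `w ^ 4 = 1/4` and `w ^ 2 = 1/2`
remain. -/
theorem IsLogicalTriple.magic_reducedState (hg : IsStabilizerGenerators g)
    [Fintype (stabGroup g)] (h : IsLogicalTriple (stabGroup g) X Y Z) {ρ : Op ι}
    (hρ : ρ = ((1 / 2 ^ Fintype.card ι : ℝ) : ℂ) •
      ((1 + ((1 / Real.sqrt 2 : ℝ) : ℂ) • (Z - Y)) * ∑ s : stabGroup g, (s : Op ι)))
    (A : Finset ι) (hA : Nat.card (hg.supported A) ≠ 0) :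
    magic (reducedState A ρ) =
      -Real.logb 2 ((1 + (reducibleCount (stabGroup g) A Y Z : ℝ) / 4) /
        (1 + (reducibleCount (stabGroup g) A Y Z : ℝ) / 2)) := by
  have hA' : (Nat.card (hg.supported A) : ℝ) ≠ 0 := Nat.cast_ne_zero.2 hA
  have h2 : (1 / Real.sqrt 2) ^ 2 = 1 / 2 := by
    rw [div_pow, Real.sq_sqrt zero_le_two, one_pow]
  have h4 : (1 / Real.sqrt 2) ^ 4 = 1 / 4 := by
    rw [show 4 = 2 * 2 from rfl, pow_mul, h2]
    norm_num
  rw [magic, sum_reducedState A ρ fun z => z.re ^ 4, sum_reducedState A ρ fun z => z.re ^ 2,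
    h.sum_trace_eq hg hρ A (fun x => x ^ 4) (by simp) (fun x => by ring),
    h.sum_trace_eq hg hρ A (fun x => x ^ 2) (by simp) (fun x => by ring),
    mul_div_mul_left _ _ hA', h2, h4]
  simp only [one_pow, mul_one_div]

/-- The left side is divisible by 3, and among 2, 3, 4 only 3 is. -/
theorem eq_one_of_two_pow_mul_eq {a b p q : ℕ} (h : 2 ^ a * (2 + p) = 2 ^ b * (2 + q))
    (hp : p = 1) (hq : q ≤ 2) : q = 1 := by
  subst hp
  have h3 : 3 ∣ 2 ^ b * (2 + q) := h ▸ Dvd.intro_left _ rfl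
  have h3' : 3 ∣ 2 + q :=
    (Nat.Coprime.pow_right b (by norm_num : Nat.Coprime 3 2)).dvd_of_dvd_mul_left h3
  omega

theorem reducibleCount_le (G : Submonoid (Op ι)) (S : Finset ι) (Y Z : Op ι) :
    reducibleCount G S Y Z ≤ 2 := by
  rw [reducibleCount]
  split_ifs <;> norm_num

/-- For a pure state, exactly one of `Z` and `Y` is reducible to `A` only if the same holds for the
complement of `A`. -/
theorem IsLogicalTriple.reducibleCount_compl (hg : IsStabilizerGenerators g)
    [Fintype (stabGroup g)] (h : IsLogicalTriple (stabGroup g) X Y Z)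
    {u v : (ι → Fin 2) → ℂ}
    (hρ : Matrix.vecMulVec u v = ((1 / 2 ^ Fintype.card ι : ℝ) : ℂ) •
      ((1 + ((1 / Real.sqrt 2 : ℝ) : ℂ) • (Z - Y)) * ∑ s : stabGroup g, (s : Op ι)))
    {A : Finset ι} {nA nB : ℕ} (hA : Nat.card (hg.supported A) = 2 ^ nA)
    (hB : Nat.card (hg.supported Aᶜ) = 2 ^ nB) :
    reducibleCount (stabGroup g) A Y Z = 1 ↔ reducibleCount (stabGroup g) Aᶜ Y Z = 1 := by
  have h2 : (1 / Real.sqrt 2) ^ 2 = 1 / 2 := by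
    rw [div_pow, Real.sq_sqrt zero_le_two, one_pow]
  -- The coefficients are real, so the complex purity identity becomes one about real squares.
  have hre : ∀ Q, Matrix.trace (pauliString Q * Matrix.vecMulVec u v) =
      ((Matrix.trace (pauliString Q * Matrix.vecMulVec u v)).re : ℂ) := fun Q =>
    Complex.ext rfl ((h.sum_trace hg hρ).1 Q)
  have key := sum_trace_sq_compl A u v
  rw [Finset.sum_congr rfl fun Q _ => congrArg (· ^ 2) (hre Q),
    Finset.sum_congr (s₁ := supportedStrings Aᶜ) rfl fun Q _ => congrArg (· ^ 2) (hre Q)] at key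
  norm_cast at key
  push_cast at key
  rw [h.sum_trace_eq hg hρ A (fun x => x ^ 2) (by simp) (fun x => by ring),
    h.sum_trace_eq hg hρ Aᶜ (fun x => x ^ 2) (by simp) (fun x => by ring), h2, hA, hB] at key
  have key' : 2 ^ (Aᶜ.card + nA) * (2 + reducibleCount (stabGroup g) A Y Z) =
      2 ^ (A.card + nB) * (2 + reducibleCount (stabGroup g) Aᶜ Y Z) := by
    have : ((2 ^ (Aᶜ.card + nA) * (2 + reducibleCount (stabGroup g) A Y Z) : ℕ) : ℝ) =
        (2 ^ (A.card + nB) * (2 + reducibleCount (stabGroup g) Aᶜ Y Z) : ℕ) := by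
      push_cast at key ⊢
      rw [pow_add, pow_add]
      linear_combination 2 * key
    exact_mod_cast this
  exact ⟨fun e => eq_one_of_two_pow_mul_eq key' e (reducibleCount_le _ _ _ _),
    fun e => eq_one_of_two_pow_mul_eq key'.symm e (reducibleCount_le _ _ _ _)⟩

theorem neg_logb_two_div (a b : ℝ) : -Real.logb 2 (a / b) = Real.logb 2 (b / a) := by
  rw [← Real.logb_inv, inv_div]

end Cases

end MagicGauge

end

/-! ### The theorem -/

open MagicGauge
theorem theorem1 (L : ℕ) (hL : 1 ≤ L)
    (ψ : (Fin L → Fin 2) → ℂ) (hψ : star ψ ⬝ᵥ ψ = 1)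
    (g : Fin (L - 1) → Op (Fin L)) (hg : IsStabilizerGenerators g)
    (X Y Z : Op (Fin L)) (hlog : IsLogicalTriple (stabGroup g) X Y Z)
    (ρ : Op (Fin L)) (hpure : ρ = Matrix.vecMulVec ψ (star ψ))
    (hρ : ρ = ((1 / 2 ^ L : ℝ) : ℂ) •
      ((1 + ((1 / Real.sqrt 2 : ℝ) : ℂ) • (Z - Y)) * (List.ofFn fun j => 1 + g j).prod))
    (A : Finset (Fin L)) :
    (∃ (nA nB m : ℕ) (a : Fin nA → Op (Fin L)) (b : Fin nB → Op (Fin L)) (h : Fin m → Op (Fin L))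
        (gen : Fin nA ⊕ Fin nB ⊕ Fin m → Op (Fin L)) (X' Y' Z' : Op (Fin L)),
      gen = Sum.elim a (Sum.elim b h) ∧
      L - 1 = nA + nB + m ∧
      -- `a`, `b`, `h` are independent generators of the same stabilizer group
      IsStabilizerGenerators gen ∧ stabGroup gen = stabGroup g ∧
      -- `X'`, `Y'`, `Z'` are equivalent logical operators of the same code
      IsLogicalTriple (stabGroup g) X' Y' Z' ∧
      IsGaugeRepresentative (stabGroup g) A X X' ∧
      IsGaugeRepresentative (stabGroup g) A Y Y' ∧
      IsGaugeRepresentative (stabGroup g) A Z Z' ∧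
      -- the factorized form of the state
      ρ = ((1 / 2 : ℂ) • (1 : Op (Fin L)) +
            ((1 / (2 * Real.sqrt 2) : ℝ) : ℂ) • (Z' - Y')) *
          (List.ofFn fun i => (1 / 2 : ℂ) • (1 + a i)).prod *
          (List.ofFn fun j => (1 / 2 : ℂ) • (1 + b j)).prod *
          (List.ofFn fun k => (1 / 2 : ℂ) • (1 + h k)).prod ∧
      -- `a` lives on `A` only, `b` on the complement of `A` only, `h` on neither
      (∀ i, SupportedOn A (a i) ∧ ¬ GeneratorReducible gen Aᶜ (Sum.inl i)) ∧
      (∀ j, SupportedOn Aᶜ (b j) ∧ ¬ GeneratorReducible gen A (Sum.inr (Sum.inl j))) ∧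
      (∀ k, ¬ GeneratorReducible gen A (Sum.inr (Sum.inr k)) ∧
        ¬ GeneratorReducible gen Aᶜ (Sum.inr (Sum.inr k)))) ∧
    -- exactly one of five cases occurs, and it determines the magic of the subsystem
    ((LogicalReducible (stabGroup g) A Z ∧ ¬ LogicalReducible (stabGroup g) Aᶜ Z ∧
        LogicalReducible (stabGroup g) A Y ∧ ¬ LogicalReducible (stabGroup g) Aᶜ Y ∧
        magic (reducedState A ρ) = Real.logb 2 (4 / 3)) ∨
      (¬ LogicalReducible (stabGroup g) A Z ∧ LogicalReducible (stabGroup g) Aᶜ Z ∧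
        ¬ LogicalReducible (stabGroup g) A Y ∧ LogicalReducible (stabGroup g) Aᶜ Y ∧
        magic (reducedState A ρ) = 0) ∨
      (¬ LogicalReducible (stabGroup g) A Z ∧ ¬ LogicalReducible (stabGroup g) Aᶜ Z ∧
        ¬ LogicalReducible (stabGroup g) A Y ∧ ¬ LogicalReducible (stabGroup g) Aᶜ Y ∧
        magic (reducedState A ρ) = 0) ∨
      (LogicalReducible (stabGroup g) A Z ∧ LogicalReducible (stabGroup g) Aᶜ Z ∧
        ¬ LogicalReducible (stabGroup g) A Y ∧ ¬ LogicalReducible (stabGroup g) Aᶜ Y ∧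
        magic (reducedState A ρ) = Real.logb 2 (6 / 5)) ∨
      (¬ LogicalReducible (stabGroup g) A Z ∧ ¬ LogicalReducible (stabGroup g) Aᶜ Z ∧
        LogicalReducible (stabGroup g) A Y ∧ LogicalReducible (stabGroup g) Aᶜ Y ∧
        magic (reducedState A ρ) = Real.logb 2 (6 / 5))) := by
  obtain ⟨nA, nB, m, a, b, h, hn, hgen, hG, ha, hb, hh, cA, cB, cG⟩ := hg.exists_bipartite A
  -- An infinite type has `Nat.card` zero, whereas this one is a power of two.
  have : Finite (stabGroup g) := Nat.finite_of_card_ne_zero (by rw [cG]; positivity)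
  let _ : Fintype (stabGroup g) := Fintype.ofFinite _
  have hρ' := hρ
  rw [hg.prod_eq_sum] at hρ'
  constructor
  · obtain ⟨s, hs, t, ht, hX, hY, hZ⟩ := hlog.exists_gauge_representatives hg A
    refine ⟨nA, nB, m, a, b, h, _, X * s, Y * (s * t), Z * t, rfl, hn, hgen, hG,
      hlog.mul_stabilizers hg hs ht, hX, hY, hZ, ?_, ha, hb, hh⟩
    -- Absorption by the group sum lets the new representatives of `Y` and `Z` replace the old ones
    -- in `ρ`.
    have habs : ∀ u ∈ stabGroup g, u * ∑ s : stabGroup g, (s : Op (Fin L)) =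
        ∑ s : stabGroup g, (s : Op (Fin L)) := fun u hu => by
      have e : u * ∑ s : stabGroup g, (s : Op (Fin L)) =
          (∑ s : stabGroup g, (s : Op (Fin L))) * u := by
        rw [Finset.mul_sum, Finset.sum_mul]
        exact Finset.sum_congr rfl fun s _ => hg.commute hu s.2
      rw [e, sum_mul_of_mem _ hu (hg.mul_self hu)]
    have hprod := hgen.prod_mul_prod_mul_prod_eq_sum hG (by rw [cG, hn])
    -- The additional factor `1/2` is the one in front of the logical part.
    have hL' : L = nA + nB + m + 1 := by omega
    rw [prod_ofFn_smul, prod_ofFn_smul, prod_ofFn_smul, mul_assoc, mul_assoc,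
      smul_mul_smul_comm, smul_mul_smul_comm, ← mul_assoc (List.prod _), hprod, hρ',
      Matrix.mul_smul, add_mul, add_mul, Matrix.smul_mul, Matrix.smul_mul, Matrix.smul_mul,
      sub_mul, sub_mul, mul_assoc Z, mul_assoc Y, habs t ht, habs _ (mul_mem hs ht), smul_add,
      smul_add, smul_smul, smul_smul]
    have e₁ : ((1 / 2 ^ L : ℝ) : ℂ) = (1 / 2) ^ nA * ((1 / 2) ^ nB * (1 / 2) ^ m) * (1 / 2) := by
      rw [hL']
      push_cast
      simp only [one_div, inv_pow, pow_add, pow_one, mul_inv]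
      ring
    have e₂ : ((1 / (2 * Real.sqrt 2) : ℝ) : ℂ) = 1 / 2 * ((1 / Real.sqrt 2 : ℝ) : ℂ) := by
      push_cast
      ring
    simp only [e₁, e₂, smul_smul, mul_assoc]
  · have hρ'' : ρ = ((1 / 2 ^ Fintype.card (Fin L) : ℝ) : ℂ) •
        ((1 + ((1 / Real.sqrt 2 : ℝ) : ℂ) • (Z - Y)) *
          ∑ s : stabGroup g, (s : Op (Fin L))) := by
      rw [Fintype.card_fin]
      exact hρ'
    have hmagic := hlog.magic_reducedState hg hρ'' A (by rw [cA]; positivity)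
    rw [hpure] at hρ''
    have hcount := hlog.reducibleCount_compl hg hρ'' cA cB
    have hZY := fun r => hg.not_reducible_compl hlog.pauli_Z hlog.pauli_Y hlog.comm_Z hlog.comm_Y
      hlog.Z_mul_Y (S := A) r
    have hYZ := fun r => hg.not_reducible_compl hlog.pauli_Y hlog.pauli_Z hlog.comm_Y hlog.comm_Z
      (neg_eq_iff_eq_neg.2 hlog.Z_mul_Y).symm (S := A) r
    rw [neg_logb_two_div] at hmagic
    rw [hmagic]
    -- Of the sixteen patterns, `hcount`, `hZY` and `hYZ` exclude all but the five listed.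
    by_cases zA : LogicalReducible (stabGroup g) A Z <;>
      by_cases yA : LogicalReducible (stabGroup g) A Y <;>
      by_cases zB : LogicalReducible (stabGroup g) Aᶜ Z <;>
      by_cases yB : LogicalReducible (stabGroup g) Aᶜ Y <;>
      simp [reducibleCount, zA, yA, zB, yB] at hcount hZY hYZ ⊢ <;> norm_num
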